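/- Let $\mathcal A$ be a finite set of $d$ treatment levels, $\mathcal X$ a standard Borel space (e.g. a Borel subset of $\mathbb R^p$), $k\ge 1$ and $1\le\Lambda<\infty$. For a probability distribution $Q$ of $(X,(Y(a))_{a\in\mathcal A},A,U)$ on $\mathcal X\times\mathbb R^{d}\times\mathcal A\times\mathbb R^k$, say that $Q$ satisfies the multi-valued marginal sensitivity model (MSM) with parameter $\Lambda$ if $(Y(a))_{a\in\mathcal A}$ and $A$ are conditionally independent given $(X,U)$ under $Q$ and, $Q$-almost surely, for all $a\in\mathcal A$, $$\frac1\Lambda\le\frac{\mathbb P_Q(A=a\mid X,U)/(1-\mathbb P_Q(A=a\mid X,U))}{\mathbb P_Q(A=a\mid X)/(1-\mathbb P_Q(A=a\mid X))}\le\Lambda ,$$ where it is understood that the propensity scores $\mathbb P_Q(A=a\mid X)$ and $\mathbb P_Q(A=a\mid X,U)$ lie in $(0,1)$ almost surely. Let $P_o$ be a distribution satisfying the MSM, let $P$ be the distribution of the observed data $(X,Y,A)$, $Y=Y(A)$, under $P_o$, and suppose $\mathbb E|Y|<\infty$. Let $\mathcal P_{\mathrm M}$ be the set of all $Q$ that satisfy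 the MSM and under which $(X,Y(A),A)$ has distribution $P$. Write $\mu_Q(x,a)=\mathbb E_Q[Y(a)\mid X=x]$, $e_a(x)=\mathbb P(A=a\mid X=x)$, let $F(\cdot\mid x,a)$ be the conditional distribution function of $Y$ given $X=x,A=a$, and put $q^{+}(x,a)=\inf\{q:F(q\mid x,a)\ge\Lambda/(1+\Lambda)\}$, $q^{-}(x,a)=\inf\{q:F(q\mid x,a)\ge 1/(1+\Lambda)\}$, and $\mathrm{sgn}(t)=1$ if $t\ge0$, $\mathrm{sgn}(t)=-1$ if $t<0$. Let $$\mu^{+}(\cdot,a)=\sup_{Q\in\mathcal P_{\mathrm M}}\mu_Q(\cdot,a),\qquad \mu^{-}(\cdot,a)=\inf_{Q\in\mathcal P_{\mathrm M}}\mu_Q(\cdot,a),$$ where, conditional means being defined only up to null sets, supremum and infimum are the essential ones with respect to the law $P_X$ of $X$ (the least measurable almost-everywhere upper bound and the greatest measurable almost-everywhere lower bound). Then for every $Q\in\mathcal P_{\mathrm M}$ and $a\in\mathcal A$, $Y(a)$ has a finite conditional mean given $X=x$ for $P_X$-almost every $x$; the bounds $\mu^\pm(\cdot,a)$ exist as real-valued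 functions; and for every $a\in\mathcal A$ there are distributions $P^{+}_{\mu,a},P^{-}_{\mu,a}\in\mathcal P_{\mathrm M}$ such that, for $P_X$-almost every $x$, $$\mu_{P^{+}_{\mu,a}}(x,a)=\mu^{+}(x,a),\qquad \mu_{P^{-}_{\mu,a}}(x,a)=\mu^{-}(x,a).$$ Moreover, for each of the two signs, every $a\in\mathcal A$ and $P_X$-almost every $x$: if $\Lambda=1$ or the conditional distribution of $Y$ given $X=x,A=a$ has no atom at $q^{\pm}(x,a)$ (in particular, if $F(\cdot\mid x,a)$ is continuous), then $$\mu^{\pm}(x,a)=\mathbb E\Big[Y\,\mathbf 1\{A=a\}\Big(1+\frac{1-e_a(X)}{e_a(X)}\,\Lambda^{\pm\mathrm{sgn}(Y-q^{\pm}(X,a))}\Big)\,\Big|\,X=x\Big].$$ -/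

import Mathlib

open MeasureTheory ProbabilityTheory

noncomputable section

namespace MultiMSM

/-- The space `𝒳 × ℝ^d × 𝒜 × ℝ^k` of full data `(X, (Y(a))_{a ∈ 𝒜}, A, U)`; the vector of potential
outcomes is indexed by the treatment levels themselves, so `d` is the cardinality of `𝒜`. -/
abbrev FullData (𝒳 𝒜 : Type*) (k : ℕ) := 𝒳 × (𝒜 → ℝ) × 𝒜 × (Fin k → ℝ)

/-- The space of observed data `(X, Y, A)`. -/
abbrev ObsData (𝒳 𝒜 : Type*) := 𝒳 × ℝ × 𝒜

section Coordinates

variable {𝒳 𝒜 : Type*} {k : ℕ}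

/-- The covariate `X`. -/
def covariate (ω : FullData 𝒳 𝒜 k) : 𝒳 := ω.1

/-- The vector of potential outcomes `(Y(a))_{a ∈ 𝒜}`. -/
def potential (ω : FullData 𝒳 𝒜 k) : 𝒜 → ℝ := ω.2.1

/-- The treatment `A`. -/
def treatment (ω : FullData 𝒳 𝒜 k) : 𝒜 := ω.2.2.1

/-- The pair `(X, U)` of observed and unobserved confounders. -/
def confounders (ω : FullData 𝒳 𝒜 k) : 𝒳 × (Fin k → ℝ) := (ω.1, ω.2.2.2)

/-- The observed data `(X, Y, A)` with `Y = Y(A)`. -/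
def observe (ω : FullData 𝒳 𝒜 k) : ObsData 𝒳 𝒜 :=
  (covariate ω, potential ω (treatment ω), treatment ω)

theorem measurable_confounders [MeasurableSpace 𝒳] [MeasurableSpace 𝒜] :
    Measurable (confounders : FullData 𝒳 𝒜 k → 𝒳 × (Fin k → ℝ)) := by
  unfold confounders
  fun_prop

end Coordinates

section Model

variable {𝒳 𝒜 : Type*} [MeasurableSpace 𝒳] [StandardBorelSpace 𝒳]
  [Finite 𝒜] [Nonempty 𝒜] [MeasurableSpace 𝒜] [MeasurableSingletonClass 𝒜] {k : ℕ}

/-- The true propensity score `ℙ_Q(A = a | X = x, U = u)`. -/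
def trueProp (Q : ProbabilityMeasure (FullData 𝒳 𝒜 k)) (a : 𝒜) (v : 𝒳 × (Fin k → ℝ)) : ℝ :=
  (condDistrib treatment confounders (Q : Measure (FullData 𝒳 𝒜 k)) v).real {a}

/-- The nominal propensity score `ℙ_Q(A = a | X = x)`. -/
def nominalProp (Q : ProbabilityMeasure (FullData 𝒳 𝒜 k)) (a : 𝒜) (x : 𝒳) : ℝ :=
  (condDistrib treatment covariate (Q : Measure (FullData 𝒳 𝒜 k)) x).real {a}

/-- The odds `p / (1 - p)`. -/
def odds (p : ℝ) : ℝ := p / (1 - p)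

/-- The multi-valued marginal sensitivity model with parameter `Λ`, for a distribution of
`(X, (Y(a))_a, A, U)`. Since all propensity scores lie in `[0, 1]` and `1 / Λ > 0`, the lower odds
bound fails (in Lean's convention `t / 0 = 0`) as soon as one of the two propensity scores is
`0` or `1`; so the nominal propensity scores lie in `(0, 1)` almost surely, as the odds ratio
presupposes. -/
structure SatisfiesMSM (Λ : ℝ) (Q : ProbabilityMeasure (FullData 𝒳 𝒜 k)) : Prop where
  /-- `(Y(a))_{a ∈ 𝒜}` and `A` are conditionally independent given `(X, U)`. -/
  condIndep : CondIndepFun (MeasurableSpace.comap confounders inferInstance)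
    (Measurable.comap_le measurable_confounders) potential treatment
    (Q : Measure (FullData 𝒳 𝒜 k))
  /-- The odds ratio of true and nominal propensity scores lies in `[1/Λ, Λ]`. -/
  odds_ratio : ∀ᵐ ω ∂(Q : Measure (FullData 𝒳 𝒜 k)), ∀ a : 𝒜,
    1 / Λ ≤ odds (trueProp Q a (confounders ω)) / odds (nominalProp Q a (covariate ω)) ∧
    odds (trueProp Q a (confounders ω)) / odds (nominalProp Q a (covariate ω)) ≤ Λ

/-- The uncertainty set `𝒫_M`: all full-data distributions with `U ∈ ℝ^k` that satisfy the model
and induce the observed-data distribution `P`. -/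
def uncertaintySet (k : ℕ) (Λ : ℝ) (P : ProbabilityMeasure (ObsData 𝒳 𝒜)) :
    Set (ProbabilityMeasure (FullData 𝒳 𝒜 k)) :=
  {Q | SatisfiesMSM Λ Q ∧
    (Q : Measure (FullData 𝒳 𝒜 k)).map observe = (P : Measure (ObsData 𝒳 𝒜))}

/-- The conditional law of `Y(a)` given `X` under `Q`. -/
def potentialLaw (Q : ProbabilityMeasure (FullData 𝒳 𝒜 k)) (a : 𝒜) : Kernel 𝒳 ℝ :=
  condDistrib (fun ω => potential ω a) covariate (Q : Measure (FullData 𝒳 𝒜 k))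

/-- The conditional mean `μ_Q(x, a) = 𝔼_Q[Y(a) | X = x]`. -/
def condMean (Q : ProbabilityMeasure (FullData 𝒳 𝒜 k)) (a : 𝒜) (x : 𝒳) : ℝ :=
  ∫ y, y ∂(potentialLaw Q a x)

/-- The marginal law of the covariate `X` under the observed-data distribution. -/
def covariateLaw (P : ProbabilityMeasure (ObsData 𝒳 𝒜)) : Measure 𝒳 :=
  (P : Measure (ObsData 𝒳 𝒜)).map (fun z => z.1)

/-- The nominal propensity score `e_a(x) = ℙ(A = a | X = x)` of the observed data. -/
def prop (P : ProbabilityMeasure (ObsData 𝒳 𝒜)) (a : 𝒜) (x : 𝒳) : ℝ :=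
  (condDistrib (fun z => z.2.2) (fun z => z.1) (P : Measure (ObsData 𝒳 𝒜)) x).real {a}

/-- The conditional law of `Y` given `X = x`, `A = a` in the observed data. -/
def outcomeLaw (P : ProbabilityMeasure (ObsData 𝒳 𝒜)) (a : 𝒜) (x : 𝒳) : Measure ℝ :=
  condDistrib (fun z => z.2.1) (fun z => (z.1, z.2.2)) (P : Measure (ObsData 𝒳 𝒜)) (x, a)

/-- The conditional quantile `inf {q : F(q | x, a) ≥ t}` of `Y` given `X = x`, `A = a`. -/
def condQuantile (P : ProbabilityMeasure (ObsData 𝒳 𝒜)) (t : ℝ) (a : 𝒜) (x : 𝒳) : ℝ :=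
  sInf {q : ℝ | t ≤ cdf (outcomeLaw P a x) q}

/-- The quantile `q⁺(x, a)`, of level `Λ / (1 + Λ)`. -/
def qPlus (Λ : ℝ) (P : ProbabilityMeasure (ObsData 𝒳 𝒜)) (a : 𝒜) (x : 𝒳) : ℝ :=
  condQuantile P (Λ / (1 + Λ)) a x

/-- The quantile `q⁻(x, a)`, of level `1 / (1 + Λ)`. -/
def qMinus (Λ : ℝ) (P : ProbabilityMeasure (ObsData 𝒳 𝒜)) (a : 𝒜) (x : 𝒳) : ℝ :=
  condQuantile P (1 / (1 + Λ)) a x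

open Classical in
/-- The sign function with `sgn t = 1` for `t ≥ 0` and `sgn t = -1` for `t < 0`. -/
def sgn (t : ℝ) : ℤ := if 0 ≤ t then 1 else -1

/-- `𝔼[Y 1{A = a} (1 + (1 - e_a(X)) / e_a(X) * Λ ^ sgn(Y - q⁺(X, a))) | X = x]`, an integral against
the conditional law of `(Y, A)` given `X = x`. -/
def closedFormPlus (Λ : ℝ) (P : ProbabilityMeasure (ObsData 𝒳 𝒜)) (a : 𝒜) (x : 𝒳) : ℝ :=
  ∫ w, w.1 * Set.indicator {a} 1 w.2 *
      (1 + (1 - prop P a x) / prop P a x * Λ ^ sgn (w.1 - qPlus Λ P a x))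
    ∂(condDistrib (fun z => z.2) (fun z => z.1) (P : Measure (ObsData 𝒳 𝒜)) x)

/-- `𝔼[Y 1{A = a} (1 + (1 - e_a(X)) / e_a(X) * Λ ^ (-sgn(Y - q⁻(X, a)))) | X = x]`. -/
def closedFormMinus (Λ : ℝ) (P : ProbabilityMeasure (ObsData 𝒳 𝒜)) (a : 𝒜) (x : 𝒳) : ℝ :=
  ∫ w, w.1 * Set.indicator {a} 1 w.2 *
      (1 + (1 - prop P a x) / prop P a x * Λ ^ (-sgn (w.1 - qMinus Λ P a x)))
    ∂(condDistrib (fun z => z.2) (fun z => z.1) (P : Measure (ObsData 𝒳 𝒜)) x)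

end Model

/-- `g` is (a version of) the essential supremum of the family `S` of functions: the least measurable
function that is an almost-everywhere upper bound of every member. Conditional means are defined
only up to null sets, so a supremum over an uncountable family of them is understood in this sense;
it is unique up to a null set. -/
def IsEssSup {𝒳 : Type*} [MeasurableSpace 𝒳] (m : Measure 𝒳) (S : Set (𝒳 → ℝ)) (g : 𝒳 → ℝ) : Prop :=
  Measurable g ∧ (∀ f ∈ S, f ≤ᵐ[m] g) ∧
    ∀ h : 𝒳 → ℝ, Measurable h → (∀ f ∈ S, f ≤ᵐ[m] h) → g ≤ᵐ[m] h

/-- `g` is (a version of) the essential infimum of the family `S` of functions. -/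
def IsEssInf {𝒳 : Type*} [MeasurableSpace 𝒳] (m : Measure 𝒳) (S : Set (𝒳 → ℝ)) (g : 𝒳 → ℝ) : Prop :=
  Measurable g ∧ (∀ f ∈ S, g ≤ᵐ[m] f) ∧
    ∀ h : 𝒳 → ℝ, Measurable h → (∀ f ∈ S, h ≤ᵐ[m] f) → h ≤ᵐ[m] g

end MultiMSM

end

/-! Fix `a` and `x`, and write `e` for the nominal propensity of `a`, `p` for the true one, and `F`
for the law of `Y` given `X = x`, `A = a`. The odds-ratio condition for `a` says that `e / p` lies
between `l = e + (1 - e) / Λ` and `u = e + Λ * (1 - e)`. Conditional independence gives `E[p f(X,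
Y(a))] = E[1{A = a} f(X, Y)]`, so the law of `Y(a)` given `X = x` lies between `l F` and `u F`
(`ae_potentialLaw_bounds`). In this band the mean is largest for a probability measure equal to `l
F` below some point and `u F` above it (`integral_id_le_of_restrict_le`). Its density is `e + (1 -
e) * lam` with `lam` equal to `1 / Λ` below and `Λ` above, so mass one forces the level `t` with `t
/ Λ + Λ * (1 - t) = 1`, that is `t = Λ / (1 + Λ)`; an atom at the quantile receives an intermediate
weight. Exchanging `Λ` and `1 / Λ` gives the minimum, at level `1 / (1 + Λ)`.

The bound is attained because every weight `lam` with values in `[1 / Λ, Λ]` and `F`-mean one comes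
from a member of the uncertainty set (`exists_mem_uncertaintySet`). Take `U = Y(a)`, let `Y(a)` have
density `N = e + (1 - e) * lam` with respect to `F`, let the treatment probabilities given `(X, U)`
be `e / N` for `a` and `e_b * lam / N` for `b ≠ a`, and draw the other outcomes from their observed
conditional laws, independently of `(Y(a), A)` given `X`. One member thus attains the bound at
almost every `x`, so the essential supremum is a maximum. -/

noncomputable section

namespace MultiMSM

open scoped ENNReal

set_option linter.unusedSectionVars false

/-! ### Quantiles and two-valued densities on the line -/

section

/-- The quantile `inf {q : F q ≥ t}` of a probability measure on the line. -/
def quantile (F : Measure ℝ) (t : ℝ) : ℝ := sInf {q : ℝ | t ≤ cdf F q}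

/-- Right continuity of the distribution function makes the infimum attained; `0 < t < 1` keeps the
set nonempty and bounded below, so that `sInf` is not a default value. -/
theorem quantile_le_iff (F : Measure ℝ) {t : ℝ} (ht0 : 0 < t) (ht1 : t < 1) (r : ℝ) :
    quantile F t ≤ r ↔ t ≤ cdf F r := by
  have hbdd : BddBelow {q : ℝ | t ≤ cdf F q} := by
    obtain ⟨m, hm⟩ := (((tendsto_cdf_atBot F).eventually (gt_mem_nhds ht0)).exists)
    refine ⟨m, fun q hq => ?_⟩
    by_contra! h
    exact absurd (lt_of_le_of_lt (hq.trans (monotone_cdf F h.le)) hm) (lt_irrefl _)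
  have hne : {q : ℝ | t ≤ cdf F q}.Nonempty := by
    obtain ⟨m, hm⟩ := (((tendsto_cdf_atTop F).eventually (lt_mem_nhds ht1)).exists)
    exact ⟨m, hm.le⟩
  refine ⟨fun h => ?_, fun h => csInf_le hbdd h⟩
  refine ge_of_tendsto (((cdf F).right_continuous r).mono_left
    (nhdsWithin_mono r Set.Ioi_subset_Ici_self)) ?_
  filter_upwards [self_mem_nhdsWithin] with s hs
  obtain ⟨q, hq, hqs⟩ := exists_lt_of_csInf_lt hne (lt_of_le_of_lt h hs)
  exact le_trans hq (monotone_cdf F hqs.le)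

theorem le_measureReal_Iic_quantile (F : Measure ℝ) [IsProbabilityMeasure F] {t : ℝ}
    (ht0 : 0 < t) (ht1 : t < 1) : t ≤ F.real (Set.Iic (quantile F t)) := by
  rw [← cdf_eq_real]
  exact (quantile_le_iff F ht0 ht1 _).1 le_rfl

/-- The mass of the open half-line is the left limit of the distribution function, which stays below
`t` to the left of the quantile. -/
theorem measureReal_Iio_quantile_le (F : Measure ℝ) [IsProbabilityMeasure F] {t : ℝ}
    (ht0 : 0 < t) (ht1 : t < 1) : F.real (Set.Iio (quantile F t)) ≤ t := by
  have h : Filter.Tendsto (cdf F) (nhdsWithin (quantile F t) (Set.Iio (quantile F t)))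
      (nhds (F.real (Set.Iio (quantile F t)))) := by
    have h1 := (monotone_cdf F).tendsto_leftLim (quantile F t)
    have h2 := (cdf F).measure_Iio (tendsto_cdf_atBot F) (quantile F t)
    rw [measure_cdf, sub_zero] at h2
    have h3 : F.real (Set.Iio (quantile F t)) = Function.leftLim (cdf F) (quantile F t) := by
      rw [measureReal_def, h2, ENNReal.toReal_ofReal]
      exact ge_of_tendsto h1 (Filter.Eventually.of_forall fun y => cdf_nonneg F y)
    rwa [h3]
  refine le_of_tendsto h ?_
  filter_upwards [self_mem_nhdsWithin] with s hs
  by_contra! hlt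
  exact absurd ((quantile_le_iff F ht0 ht1 s).2 hlt.le) (not_le.2 hs)

/-- The density that equals `α` below `q` and `β` above `q`, and whose value at `q` distributes the
mass of a possible atom so that the total mass is `α * t + β * (1 - t)`. -/
def tilt (F : Measure ℝ) (q t α β y : ℝ) : ℝ :=
  if y < q then α else if q < y then β else
    if F.real {q} = 0 then β else
      (α * (t - F.real (Set.Iio q)) + β * (F.real (Set.Iic q) - t)) / F.real {q}

theorem measureReal_Iic_eq (F : Measure ℝ) [IsFiniteMeasure F] (q : ℝ) :
    F.real (Set.Iic q) = F.real (Set.Iio q) + F.real {q} := by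
  rw [← measureReal_union (by simp) (measurableSet_singleton q), Set.Iio_union_right]

theorem measurable_tilt (F : Measure ℝ) (q t α β : ℝ) : Measurable (tilt F q t α β) := by
  unfold tilt
  exact Measurable.ite measurableSet_Iio measurable_const
    (Measurable.ite measurableSet_Ioi measurable_const measurable_const)

/-- At an atom the value is a convex combination of `α` and `β`: `h1` and `h2` make the two weights
nonnegative, and their sum is one. -/
theorem tilt_mem_Icc {F : Measure ℝ} [IsFiniteMeasure F] {q t α β lo hi : ℝ}
    (h1 : F.real (Set.Iio q) ≤ t) (h2 : t ≤ F.real (Set.Iic q))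
    (hα : α ∈ Set.Icc lo hi) (hβ : β ∈ Set.Icc lo hi) (y : ℝ) :
    tilt F q t α β y ∈ Set.Icc lo hi := by
  unfold tilt
  split_ifs with _ _ h0
  · exact hα
  · exact hβ
  · exact hβ
  · have hp : 0 < F.real {q} := lt_of_le_of_ne measureReal_nonneg (Ne.symm h0)
    have h3 : F.real {q} = F.real (Set.Iic q) - F.real (Set.Iio q) := by
      rw [measureReal_Iic_eq]; ring
    constructor
    · rw [le_div_iff₀ hp, h3]
      nlinarith [mul_nonneg (sub_nonneg.2 hα.1) (sub_nonneg.2 h1),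
        mul_nonneg (sub_nonneg.2 hβ.1) (sub_nonneg.2 h2)]
    · rw [div_le_iff₀ hp, h3]
      nlinarith [mul_nonneg (sub_nonneg.2 hα.2) (sub_nonneg.2 h1),
        mul_nonneg (sub_nonneg.2 hβ.2) (sub_nonneg.2 h2)]

theorem integral_tilt {F : Measure ℝ} [IsProbabilityMeasure F] {q t α β : ℝ}
    (h1 : F.real (Set.Iio q) ≤ t) (h2 : t ≤ F.real (Set.Iic q)) :
    ∫ y, tilt F q t α β y ∂F = α * t + β * (1 - t) := by
  have h3 := measureReal_Iic_eq F q
  have h4 : F.real (Set.Ioi q) = 1 - F.real (Set.Iic q) := by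
    rw [← Set.compl_Iic, measureReal_compl measurableSet_Iic]; simp
  set c : ℝ := if F.real {q} = 0 then β else
      (α * (t - F.real (Set.Iio q)) + β * (F.real (Set.Iic q) - t)) / F.real {q} with hc
  have hdec : tilt F q t α β = fun y => (Set.Iio q).indicator (fun _ => α) y +
      ((Set.Ioi q).indicator (fun _ => β) y + ({q} : Set ℝ).indicator (fun _ => c) y) := by
    funext y
    rcases lt_trichotomy y q with h | h | h
    · simp [tilt, h, h.ne, h.le]
    · simp [tilt, h, hc]
    · simp [tilt, h, h.ne', not_lt.2 h.le]
  rw [hdec, integral_add, integral_add, integral_indicator_const _ measurableSet_Iio,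
    integral_indicator_const _ measurableSet_Ioi,
    integral_indicator_const _ (measurableSet_singleton q)]
  · simp only [smul_eq_mul, h4]
    by_cases h0 : F.real {q} = 0
    -- Without an atom, `h1` and `h2` squeeze the mass below `q` to exactly `t`.
    · have : F.real (Set.Iio q) = t := by linarith
      rw [h3, h0, this]; ring
    · rw [hc, if_neg h0, mul_div_cancel₀ _ h0]; ring
  · exact (integrable_const _).indicator measurableSet_Ioi
  · exact (integrable_const _).indicator (measurableSet_singleton q)
  · exact (integrable_const _).indicator measurableSet_Iio
  · exact ((integrable_const _).indicator measurableSet_Ioi).add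
      ((integrable_const _).indicator (measurableSet_singleton q))

/-! ### Measurability, comparison and coupling of kernels -/

section Kernels

variable {𝒳 : Type*} [MeasurableSpace 𝒳]

/-- By `quantile_le_iff`, sublevel sets of the quantile are superlevel sets of `κ x (Iic r)`. -/
theorem measurable_quantile (κ : Kernel 𝒳 ℝ) [IsMarkovKernel κ] {t : ℝ} (ht0 : 0 < t)
    (ht1 : t < 1) : Measurable fun x => quantile (κ x) t := by
  refine measurable_of_Iic fun r => ?_
  have : (fun x => quantile (κ x) t) ⁻¹' Set.Iic r = {x | t ≤ (κ x).real (Set.Iic r)} := by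
    ext x
    simp [quantile_le_iff (κ x) ht0 ht1, cdf_eq_real]
  rw [this]
  exact measurableSet_le measurable_const
    (κ.measurable_coe measurableSet_Iic).ennreal_toReal

theorem measurable_tilt_kernel (κ : Kernel 𝒳 ℝ) [IsMarkovKernel κ] {q : 𝒳 → ℝ}
    (hq : Measurable q) (t α β : ℝ) :
    Measurable fun p : 𝒳 × ℝ => tilt (κ p.1) (q p.1) t α β p.2 := by
  have hs : ∀ {s : Set (𝒳 × ℝ)}, MeasurableSet s →
      Measurable fun x => (κ x).real (Prod.mk x ⁻¹' s) := fun hs =>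
    (Kernel.measurable_kernel_prodMk_left hs).ennreal_toReal
  have e1 : Measurable fun x => (κ x).real {q x} :=
    hs (measurableSet_eq_fun measurable_snd (hq.comp measurable_fst))
  have e2 : Measurable fun x => (κ x).real (Set.Iio (q x)) :=
    hs (measurableSet_lt measurable_snd (hq.comp measurable_fst))
  have e3 : Measurable fun x => (κ x).real (Set.Iic (q x)) :=
    hs (measurableSet_le measurable_snd (hq.comp measurable_fst))
  unfold tilt
  refine Measurable.ite (measurableSet_lt measurable_snd (hq.comp measurable_fst))
    measurable_const (Measurable.ite (measurableSet_lt (hq.comp measurable_fst) measurable_snd)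
      measurable_const (Measurable.ite ?_ measurable_const ?_))
  · exact (e1.comp measurable_fst) (measurableSet_singleton 0)
  · exact (((((e2.comp measurable_fst).const_sub t).const_mul α).add
      (((e3.comp measurable_fst).sub_const t).const_mul β)).div (e1.comp measurable_fst))

/-- If `μ ⊗ₘ κ ≤ μ ⊗ₘ η`, then `κ x ≤ η x` for almost every `x`. -/
theorem ae_le_of_compProd_le {β : Type*} [MeasurableSpace β]
    [MeasurableSpace.CountableOrCountablyGenerated 𝒳 β]
    {μ : Measure 𝒳} [IsFiniteMeasure μ] {κ η : Kernel 𝒳 β} [IsFiniteKernel κ]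
    [IsFiniteKernel η] (h : μ ⊗ₘ κ ≤ μ ⊗ₘ η) : ∀ᵐ x ∂μ, κ x ≤ η x := by
  have h_ac : ∀ᵐ a ∂μ, κ a ≪ η a :=
    (Measure.absolutelyContinuous_of_le h).kernel_of_compProd
  have hκ_eq : ∀ᵐ a ∂μ, κ a = η.withDensity (κ.rnDeriv η) a := by
    filter_upwards [h_ac] with a ha using (Kernel.withDensity_rnDeriv_eq ha).symm
  -- The integral of the density over each `s` is at most the measure of `s`, so the density is at
  -- most one almost everywhere.
  have hle : ∀ᵐ a ∂μ, ∀ᵐ b ∂(η a), κ.rnDeriv η a b ≤ 1 := by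
    refine Measure.ae_ae_of_ae_compProd (p := fun x => κ.rnDeriv η x.1 x.2 ≤ 1) ?_
    refine ae_le_of_forall_setLIntegral_le_of_sigmaFinite (by fun_prop) fun s hs _ => ?_
    calc ∫⁻ x in s, κ.rnDeriv η x.1 x.2 ∂μ ⊗ₘ η = (μ ⊗ₘ κ) s := by
          rw [Measure.compProd_congr hκ_eq, Measure.compProd_withDensity, withDensity_apply _ hs]
          fun_prop
      _ ≤ (μ ⊗ₘ η) s := h s
      _ = ∫⁻ _ in s, 1 ∂μ ⊗ₘ η := by simp
  filter_upwards [hκ_eq, hle] with x hx hx'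
  rw [hx, Kernel.withDensity_apply _ (by fun_prop)]
  calc (η x).withDensity (κ.rnDeriv η x) ≤ (η x).withDensity 1 := withDensity_mono hx'
    _ = η x := withDensity_one

/-- Markov kernels to the line can be coupled. -/
theorem exists_coupling {ι : Type*} [Countable ι] (F : ι → Kernel 𝒳 ℝ)
    [∀ i, IsMarkovKernel (F i)] :
    ∃ H : Kernel 𝒳 (ι → ℝ), IsMarkovKernel H ∧
      ∀ i x, (H x).map (fun z => z i) = F i x := by
  -- Each kernel is the image of the uniform law under a measurable map; feeding the same uniform
  -- variable to all of them gives a joint law. Only the marginals matter later.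
  choose f hf hmap using fun i => Kernel.exists_measurable_map_eq_unitInterval (F i)
  have hm : Measurable fun p : 𝒳 × unitInterval => fun i => f i p.1 p.2 :=
    measurable_pi_lambda _ fun i => hf i
  refine ⟨(Kernel.id ×ₖ Kernel.const 𝒳 (volume : Measure unitInterval)).map
    fun p i => f i p.1 p.2, Kernel.IsMarkovKernel.map _ hm, fun i x => ?_⟩
  have hfx : Measurable (f i x) := (hf i).comp measurable_prodMk_left
  rw [Kernel.map_apply _ hm, Measure.map_map (measurable_pi_apply i) hm, ← hmap i x,
    Kernel.prod_apply, Kernel.id_apply, Kernel.const_apply, Measure.dirac_prod,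
    Measure.map_map ((measurable_pi_apply i).comp hm) measurable_prodMk_left]
  rfl

end Kernels

/-- A comparison of means: `M` puts more mass than `L` to the right of `q` and less to the left. -/
theorem integral_id_le_of_restrict_le {L M : Measure ℝ} [IsProbabilityMeasure L]
    [IsProbabilityMeasure M] (hL : Integrable (fun y : ℝ => y) L)
    (hM : Integrable (fun y : ℝ => y) M) (q : ℝ)
    (h1 : L.restrict (Set.Ioi q) ≤ M.restrict (Set.Ioi q))
    (h2 : M.restrict (Set.Iio q) ≤ L.restrict (Set.Iio q)) :
    ∫ y, y ∂L ≤ ∫ y, y ∂M := by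
  -- The mean is split into positive and negative parts of `y - q`. The point `q` contributes
  -- nothing, so the mass of an atom there need not be compared.
  have key : ∀ N : Measure ℝ, IsProbabilityMeasure N → Integrable (fun y : ℝ => y) N →
      ∫ y, y ∂N = q + (∫ y in Set.Ioi q, (y - q) ∂N) - ∫ y in Set.Iio q, (q - y) ∂N := by
    intro N _ hN
    have hi : Integrable (fun y : ℝ => y - q) N := hN.sub (integrable_const q)
    have hi' : Integrable (fun y : ℝ => q - y) N := (integrable_const q).sub hN
    rw [← integral_indicator measurableSet_Ioi, ← integral_indicator measurableSet_Iio,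
      add_sub_assoc, ← integral_sub (hi.indicator measurableSet_Ioi)
        (hi'.indicator measurableSet_Iio)]
    have : (fun y : ℝ => (Set.Ioi q).indicator (fun y => y - q) y -
        (Set.Iio q).indicator (fun y => q - y) y) = fun y => y - q := by
      funext y
      rcases lt_trichotomy y q with h | h | h
      · simp [h, h.le]
      · simp [h]
      · simp [h, h.le]
    rw [this, integral_sub hN (integrable_const q)]
    simp
  rw [key L inferInstance hL, key M inferInstance hM]
  have e1 : ∫ y in Set.Ioi q, (y - q) ∂L ≤ ∫ y in Set.Ioi q, (y - q) ∂M := by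
    refine integral_mono_measure h1 ?_ (hM.sub (integrable_const q)).integrableOn
    filter_upwards [ae_restrict_mem measurableSet_Ioi] with y hy using sub_nonneg.2 (le_of_lt hy)
  have e2 : ∫ y in Set.Iio q, (q - y) ∂M ≤ ∫ y in Set.Iio q, (q - y) ∂L := by
    refine integral_mono_measure h2 ?_ ((integrable_const q).sub hL).integrableOn
    filter_upwards [ae_restrict_mem measurableSet_Iio] with y hy using sub_nonneg.2 (le_of_lt hy)
  linarith

end

/-! ### Disintegration of the observed data -/

section

section Density

variable {𝒳 β : Type*} [MeasurableSpace 𝒳] [MeasurableSpace β]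

/-- The kernel `x ↦ c x • κ x`. -/
def scaleKernel (c : 𝒳 → ℝ≥0∞) (κ : Kernel 𝒳 β) [IsSFiniteKernel κ] : Kernel 𝒳 β :=
  κ.withDensity fun x _ => c x

theorem scaleKernel_apply {c : 𝒳 → ℝ≥0∞} (hc : Measurable c) (κ : Kernel 𝒳 β)
    [IsSFiniteKernel κ] (x : 𝒳) : scaleKernel c κ x = c x • κ x := by
  rw [scaleKernel, Kernel.withDensity_apply _ (by fun_prop), withDensity_const]

theorem isFiniteKernel_scaleKernel {c : 𝒳 → ℝ≥0∞} {C : ℝ≥0∞} (hC : C ≠ ∞)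
    (hcC : ∀ x, c x ≤ C) (κ : Kernel 𝒳 β) [IsFiniteKernel κ] :
    IsFiniteKernel (scaleKernel c κ) :=
  Kernel.isFiniteKernel_withDensity_of_bounded κ hC fun x _ => hcC x

theorem compProd_scaleKernel_apply (μ : Measure 𝒳) [SFinite μ] {c : 𝒳 → ℝ≥0∞}
    (hc : Measurable c) (κ : Kernel 𝒳 β) [IsSFiniteKernel κ] [IsSFiniteKernel (scaleKernel c κ)]
    {D : Set (𝒳 × β)} (hD : MeasurableSet D) :
    (μ ⊗ₘ scaleKernel c κ) D = ∫⁻ x, ∫⁻ y, c x * D.indicator 1 (x, y) ∂κ x ∂μ := by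
  rw [Measure.compProd_apply hD]
  refine lintegral_congr fun x => ?_
  have h1 : Measurable fun y => D.indicator (1 : 𝒳 × β → ℝ≥0∞) (x, y) :=
    (measurable_one.indicator hD).comp measurable_prodMk_left
  rw [scaleKernel_apply hc, Measure.smul_apply, smul_eq_mul, lintegral_const_mul _ h1,
    ← lintegral_indicator_one (measurable_prodMk_left hD)]
  rfl

end Density

variable {𝒳 𝒜 : Type*} [MeasurableSpace 𝒳]
  [Finite 𝒜] [Nonempty 𝒜] [MeasurableSpace 𝒜] [MeasurableSingletonClass 𝒜] {k : ℕ}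

section Observed

/-- The conditional law of the treatment given the covariate in the observed data. -/
def treatmentKernel (P : ProbabilityMeasure (ObsData 𝒳 𝒜)) : Kernel 𝒳 𝒜 :=
  condDistrib (fun z => z.2.2) (fun z => z.1) (P : Measure (ObsData 𝒳 𝒜))

/-- The conditional law of the outcome given covariate and treatment, as a kernel from `𝒳`. -/
def outcomeKernel (P : ProbabilityMeasure (ObsData 𝒳 𝒜)) (a : 𝒜) : Kernel 𝒳 ℝ :=
  (condDistrib (fun z => z.2.1) (fun z => (z.1, z.2.2)) (P : Measure (ObsData 𝒳 𝒜))).comap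
    (fun x => (x, a)) measurable_prodMk_right

variable (P : ProbabilityMeasure (ObsData 𝒳 𝒜))

instance : IsMarkovKernel (treatmentKernel P) := by
  unfold treatmentKernel; infer_instance

instance (a : 𝒜) : IsMarkovKernel (outcomeKernel P a) := by
  unfold outcomeKernel; infer_instance

instance : IsProbabilityMeasure (covariateLaw P) :=
  Measure.isProbabilityMeasure_map (by fun_prop)

theorem outcomeKernel_apply (a : 𝒜) (x : 𝒳) : outcomeKernel P a x = outcomeLaw P a x := rfl

theorem treatmentKernel_singleton (a : 𝒜) (x : 𝒳) :
    treatmentKernel P x {a} = ENNReal.ofReal (prop P a x) := by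
  rw [prop, measureReal_def, ENNReal.ofReal_toReal (measure_ne_top _ _)]; rfl

theorem prop_nonneg (a : 𝒜) (x : 𝒳) : 0 ≤ prop P a x := measureReal_nonneg

theorem prop_le_one (a : 𝒜) (x : 𝒳) : prop P a x ≤ 1 := measureReal_le_one

@[fun_prop]
theorem measurable_prop (a : 𝒜) : Measurable (prop P a) :=
  ((treatmentKernel P).measurable_coe (measurableSet_singleton a)).ennreal_toReal

/-- Integrating over `X`, then `A`, then `Y` matches the order in `lintegral_jointMeasure`, so the
two laws can be compared integrand by integrand. -/
theorem lintegral_observed {f : ObsData 𝒳 𝒜 → ℝ≥0∞} (hf : Measurable f) :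
    ∫⁻ z, f z ∂(P : Measure (ObsData 𝒳 𝒜)) =
      ∫⁻ x, ∫⁻ b, ∫⁻ y, f (x, y, b) ∂outcomeKernel P b x ∂treatmentKernel P x
        ∂covariateLaw P := by
  have h1 : covariateLaw P ⊗ₘ treatmentKernel P =
      (P : Measure (ObsData 𝒳 𝒜)).map fun z => (z.1, z.2.2) :=
    compProd_map_condDistrib (by fun_prop)
  have h2 : ((P : Measure (ObsData 𝒳 𝒜)).map fun z => (z.1, z.2.2)) ⊗ₘ
      condDistrib (fun z => z.2.1) (fun z => (z.1, z.2.2)) (P : Measure (ObsData 𝒳 𝒜)) =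
      (P : Measure (ObsData 𝒳 𝒜)).map fun z => ((z.1, z.2.2), z.2.1) :=
    compProd_map_condDistrib (by fun_prop)
  have hg : Measurable fun w : (𝒳 × 𝒜) × ℝ => f (w.1.1, w.2, w.1.2) := by fun_prop
  calc ∫⁻ z, f z ∂(P : Measure (ObsData 𝒳 𝒜))
      = ∫⁻ w, f (w.1.1, w.2, w.1.2)
          ∂((P : Measure (ObsData 𝒳 𝒜)).map fun z => ((z.1, z.2.2), z.2.1)) := by
        rw [lintegral_map hg (by fun_prop)]
    _ = _ := by
        rw [← h2, Measure.lintegral_compProd hg, ← h1, Measure.lintegral_compProd]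
        · rfl
        · exact Measurable.lintegral_kernel_prod_right' hg

theorem lintegral_observed_treated (a : 𝒜) {f : 𝒳 × ℝ → ℝ≥0∞} (hf : Measurable f) :
    ∫⁻ z, ({a} : Set 𝒜).indicator 1 z.2.2 * f (z.1, z.2.1) ∂(P : Measure (ObsData 𝒳 𝒜)) =
      ∫⁻ x, ∫⁻ y, ENNReal.ofReal (prop P a x) * f (x, y) ∂outcomeKernel P a x
        ∂covariateLaw P := by
  have hi : Measurable (({a} : Set 𝒜).indicator (1 : 𝒜 → ℝ≥0∞)) := .of_discrete
  rw [lintegral_observed P (by fun_prop)]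
  refine lintegral_congr fun x => ?_
  have hfx : Measurable fun y => f (x, y) := by fun_prop
  have h : ∀ b, ∫⁻ y, ({a} : Set 𝒜).indicator 1 b * f (x, y) ∂outcomeKernel P b x =
      ({a} : Set 𝒜).indicator (fun _ => ∫⁻ y, f (x, y) ∂outcomeKernel P a x) b := by
    intro b
    by_cases hb : b = a
    · subst hb; simp
    · simp [hb]
  simp only [h]
  rw [lintegral_indicator_const (measurableSet_singleton a), treatmentKernel_singleton,
    lintegral_const_mul _ hfx, mul_comm]

/-- The part of the conditional law of `(Y, A)` given `X` on `{A = a}`. -/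
theorem map_restrict_condDistrib_ae_eq (a : 𝒜) :
    ∀ᵐ x ∂covariateLaw P,
      ((condDistrib (fun z => z.2) (fun z => z.1) (P : Measure (ObsData 𝒳 𝒜)) x).restrict
        {w | w.2 = a}).map Prod.fst = ENNReal.ofReal (prop P a x) • outcomeKernel P a x := by
  have hm : MeasurableSet {w : ℝ × 𝒜 | w.2 = a} :=
    measurable_snd (measurableSet_singleton a)
  set κ := condDistrib (fun z => z.2) (fun z => z.1) (P : Measure (ObsData 𝒳 𝒜)) with hκ
  have hc : Measurable fun x => ENNReal.ofReal (prop P a x) := by fun_prop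
  have := isFiniteKernel_scaleKernel (C := 1) (by simp)
    (fun x => ENNReal.ofReal_le_one.2 (prop_le_one P a x)) (outcomeKernel P a)
  -- Both sides give `D` the probability of `(X, Y) ∈ D` and `A = a`; a finite kernel to the line is
  -- determined almost everywhere by its composition product.
  have h : (covariateLaw P) ⊗ₘ ((κ.restrict hm).map Prod.fst) =
      (covariateLaw P) ⊗ₘ
        scaleKernel (fun x => ENNReal.ofReal (prop P a x)) (outcomeKernel P a) := by
    ext D hD
    have hD' : Measurable (D.indicator (1 : 𝒳 × ℝ → ℝ≥0∞)) := measurable_one.indicator hD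
    have hi : Measurable (({a} : Set 𝒜).indicator (1 : 𝒜 → ℝ≥0∞)) := .of_discrete
    have hE : MeasurableSet {p : 𝒳 × (ℝ × 𝒜) | (p.1, p.2.1) ∈ D ∧ p.2.2 = a} :=
      (by fun_prop : Measurable fun p : 𝒳 × (ℝ × 𝒜) => (p.1, p.2.1)) hD |>.inter
        ((by fun_prop : Measurable fun p : 𝒳 × (ℝ × 𝒜) => p.2.2) (measurableSet_singleton a))
    rw [compProd_scaleKernel_apply _ hc _ hD, ← lintegral_observed_treated P a hD',
      Measure.compProd_apply hD]
    calc ∫⁻ x, ((κ.restrict hm).map Prod.fst) x (Prod.mk x ⁻¹' D) ∂covariateLaw P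
        = ∫⁻ x, κ x (Prod.mk x ⁻¹' {p : 𝒳 × (ℝ × 𝒜) | (p.1, p.2.1) ∈ D ∧ p.2.2 = a})
            ∂covariateLaw P := by
          refine lintegral_congr fun x => ?_
          rw [Kernel.map_apply' _ measurable_fst _ (measurable_prodMk_left hD),
            Kernel.restrict_apply,
            Measure.restrict_apply (measurable_fst (measurable_prodMk_left hD))]
          rfl
      _ = (P : Measure (ObsData 𝒳 𝒜)) {p | (p.1, p.2.1) ∈ D ∧ p.2.2 = a} := by
          rw [← Measure.compProd_apply hE, covariateLaw, hκ, compProd_map_condDistrib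
            (by fun_prop), Measure.map_apply (by fun_prop) hE]
          rfl
      _ = _ := by
          rw [← lintegral_indicator_one hE]
          refine lintegral_congr fun z => ?_
          by_cases h1 : (z.1, z.2.1) ∈ D <;> by_cases h2 : z.2.2 = a <;> simp [h1, h2]
  filter_upwards [Kernel.ae_eq_of_compProd_eq h] with x hx
  rwa [scaleKernel_apply hc, Kernel.map_apply _ measurable_fst, Kernel.restrict_apply] at hx

end Observed

end

/-! ### Consequences of the sensitivity model -/

section

variable {𝒳 𝒜 : Type*} [MeasurableSpace 𝒳] [StandardBorelSpace 𝒳]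
  [Finite 𝒜] [Nonempty 𝒜] [MeasurableSpace 𝒜] [MeasurableSingletonClass 𝒜] {k : ℕ}

section Coordinates

theorem measurable_covariate {𝒳 𝒜 : Type*} [MeasurableSpace 𝒳] [MeasurableSpace 𝒜] {k : ℕ} :
    Measurable (covariate : FullData 𝒳 𝒜 k → 𝒳) := by
  unfold covariate; fun_prop

theorem measurable_potential {𝒳 𝒜 : Type*} [MeasurableSpace 𝒳] [MeasurableSpace 𝒜] {k : ℕ} :
    Measurable (potential : FullData 𝒳 𝒜 k → 𝒜 → ℝ) := by
  unfold potential; fun_prop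

theorem measurable_treatment {𝒳 𝒜 : Type*} [MeasurableSpace 𝒳] [MeasurableSpace 𝒜] {k : ℕ} :
    Measurable (treatment : FullData 𝒳 𝒜 k → 𝒜) := by
  unfold treatment; fun_prop

theorem measurable_potential_apply {𝒳 𝒜 : Type*} [MeasurableSpace 𝒳] [MeasurableSpace 𝒜] {k : ℕ}
    (a : 𝒜) : Measurable fun ω : FullData 𝒳 𝒜 k => potential ω a :=
  (measurable_pi_apply a).comp measurable_potential

theorem measurable_observe {𝒳 𝒜 : Type*} [MeasurableSpace 𝒳] [Finite 𝒜] [MeasurableSpace 𝒜]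
    [MeasurableSingletonClass 𝒜] {k : ℕ} :
    Measurable (observe : FullData 𝒳 𝒜 k → ObsData 𝒳 𝒜) := by
  have h : Measurable fun p : 𝒜 × (𝒜 → ℝ) => p.2 p.1 :=
    measurable_from_prod_countable_right fun a => measurable_pi_apply a
  exact measurable_covariate.prodMk
    ((h.comp (measurable_treatment.prodMk measurable_potential)).prodMk measurable_treatment)

end Coordinates

/-- Conditional independence of potential outcomes and treatment given the confounders, in terms
of the joint law. -/
theorem condIndepFun_iff_map_eq_compProd (Q : ProbabilityMeasure (FullData 𝒳 𝒜 k)) :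
    CondIndepFun (MeasurableSpace.comap confounders inferInstance)
      (Measurable.comap_le measurable_confounders) potential treatment
      (Q : Measure (FullData 𝒳 𝒜 k)) ↔
    (Q : Measure (FullData 𝒳 𝒜 k)).map (fun ω => ((confounders ω, potential ω), treatment ω)) =
      ((Q : Measure (FullData 𝒳 𝒜 k)).map fun ω => (confounders ω, potential ω)) ⊗ₘ
        (condDistrib treatment confounders (Q : Measure (FullData 𝒳 𝒜 k))).prodMkRight _ := by
  rw [condIndepFun_iff_condDistrib_prod_ae_eq_prodMkRight measurable_treatment
    measurable_potential measurable_confounders, condDistrib_ae_eq_iff_measure_eq_compProd _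
    measurable_treatment.aemeasurable]

section Odds

/-- Since `t / 0 = 0`, the positive lower bound `1 / Λ` excludes propensities `0` and `1`; the rest
is clearing denominators, and bounds `e / p` without dividing by `p`. -/
theorem odds_ratio_bounds {Λ p e : ℝ} (hΛ : 1 ≤ Λ) (hp0 : 0 ≤ p) (hp1 : p ≤ 1) (he0 : 0 ≤ e)
    (he1 : e ≤ 1) (h1 : 1 / Λ ≤ odds p / odds e) (h2 : odds p / odds e ≤ Λ) :
    (0 < e ∧ e < 1) ∧ e ≤ (e + Λ * (1 - e)) * p ∧ (e + (1 - e) / Λ) * p ≤ e := by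
  have hΛ0 : 0 < Λ := by linarith
  have hpos : 0 < odds p / odds e := lt_of_lt_of_le (by positivity) h1
  have hne : ∀ r : ℝ, odds r ≠ 0 → r ≠ 0 ∧ 1 - r ≠ 0 := by
    intro r hr
    constructor <;> intro h <;> exact hr (by simp [odds, h])
  obtain ⟨hp, hp'⟩ := hne p (by rintro h; simp [h] at hpos)
  obtain ⟨he, he'⟩ := hne e (by rintro h; simp [h] at hpos)
  have hp0' : 0 < p := lt_of_le_of_ne hp0 (Ne.symm hp)
  have he0' : 0 < e := lt_of_le_of_ne he0 (Ne.symm he)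
  have hp1' : 0 < 1 - p := lt_of_le_of_ne (by linarith) (Ne.symm hp')
  have he1' : 0 < 1 - e := lt_of_le_of_ne (by linarith) (Ne.symm he')
  have heq : odds p / odds e = (p * (1 - e)) / (e * (1 - p)) := by
    unfold odds; field_simp
  rw [heq] at h1 h2
  rw [div_le_div_iff₀ hΛ0 (by positivity)] at h1
  rw [div_le_iff₀ (by positivity)] at h2
  refine ⟨⟨he0', by linarith⟩, by nlinarith, ?_⟩
  have : (e + (1 - e) / Λ) * p = e * p + (p * (1 - e)) / Λ := by ring
  rw [this]
  have : p * (1 - e) / Λ ≤ e * (1 - p) := by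
    rw [div_le_iff₀ hΛ0]; linarith
  linarith

end Odds

section UncertaintySet

variable {Λ : ℝ} {P : ProbabilityMeasure (ObsData 𝒳 𝒜)}
  {Q : ProbabilityMeasure (FullData 𝒳 𝒜 k)}

theorem map_covariate_eq (hQ : (Q : Measure (FullData 𝒳 𝒜 k)).map observe = P) :
    (Q : Measure (FullData 𝒳 𝒜 k)).map covariate = covariateLaw P := by
  rw [covariateLaw, ← hQ, Measure.map_map measurable_fst measurable_observe]
  rfl

theorem nominalProp_eq_prop (hQ : (Q : Measure (FullData 𝒳 𝒜 k)).map observe = P) (a : 𝒜) :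
    nominalProp Q a = prop P a := by
  have : condDistrib treatment covariate (Q : Measure (FullData 𝒳 𝒜 k)) =
      condDistrib (fun z => z.2.2) (fun z => z.1) (P : Measure (ObsData 𝒳 𝒜)) := by
    rw [condDistrib, condDistrib]
    congr 1
    rw [← hQ, Measure.map_map (by fun_prop) measurable_observe]
    rfl
  funext x
  rw [nominalProp, prop, this]

theorem map_covariate_potential_eq (hQ : (Q : Measure (FullData 𝒳 𝒜 k)).map observe = P)
    (a : 𝒜) : (Q : Measure (FullData 𝒳 𝒜 k)).map (fun ω => (covariate ω, potential ω a)) =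
      covariateLaw P ⊗ₘ potentialLaw Q a := by
  rw [← map_covariate_eq hQ, potentialLaw,
    compProd_map_condDistrib (measurable_potential_apply a).aemeasurable]

instance (a : 𝒜) : IsMarkovKernel (potentialLaw Q a) := by
  unfold potentialLaw; infer_instance

/-- Almost surely, the true propensity score satisfies the bounds implied by the odds ratio. -/
theorem SatisfiesMSM.ae_bounds (hΛ : 1 ≤ Λ) (h : SatisfiesMSM Λ Q)
    (hQ : (Q : Measure (FullData 𝒳 𝒜 k)).map observe = P) (a : 𝒜) :
    ∀ᵐ ω ∂(Q : Measure (FullData 𝒳 𝒜 k)),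
      (0 < prop P a (covariate ω) ∧ prop P a (covariate ω) < 1) ∧
      prop P a (covariate ω) ≤
        (prop P a (covariate ω) + Λ * (1 - prop P a (covariate ω))) *
          trueProp Q a (confounders ω) ∧
      (prop P a (covariate ω) + (1 - prop P a (covariate ω)) / Λ) *
          trueProp Q a (confounders ω) ≤ prop P a (covariate ω) := by
  filter_upwards [h.odds_ratio] with ω hω
  obtain ⟨h1, h2⟩ := hω a
  rw [nominalProp_eq_prop hQ] at h1 h2
  exact odds_ratio_bounds hΛ measureReal_nonneg measureReal_le_one (prop_nonneg P a _)
    (prop_le_one P a _) h1 h2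

theorem SatisfiesMSM.ae_prop_mem_Ioo (hΛ : 1 ≤ Λ) (h : SatisfiesMSM Λ Q)
    (hQ : (Q : Measure (FullData 𝒳 𝒜 k)).map observe = P) (a : 𝒜) :
    ∀ᵐ x ∂covariateLaw P, 0 < prop P a x ∧ prop P a x < 1 := by
  rw [← map_covariate_eq hQ, ae_map_iff measurable_covariate.aemeasurable]
  · filter_upwards [h.ae_bounds hΛ hQ a] with ω hω using hω.1
  · exact (measurable_prop P a) measurableSet_Ioo

/-- Given `(X, U)`, the treatment is independent of `Y(a)`, so the true propensity may be replaced
by the indicator of `A = a`, an event on which `Y(a)` is the observed `Y`. -/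
theorem lintegral_trueProp_mul (hci : SatisfiesMSM Λ Q)
    (hQ : (Q : Measure (FullData 𝒳 𝒜 k)).map observe = P) (a : 𝒜) {f : 𝒳 × ℝ → ℝ≥0∞}
    (hf : Measurable f) :
    ∫⁻ ω, ENNReal.ofReal (trueProp Q a (confounders ω)) * f (covariate ω, potential ω a)
        ∂(Q : Measure (FullData 𝒳 𝒜 k)) =
      ∫⁻ x, ∫⁻ y, ENNReal.ofReal (prop P a x) * f (x, y) ∂outcomeKernel P a x
        ∂covariateLaw P := by
  have hi : Measurable (({a} : Set 𝒜).indicator (1 : 𝒜 → ℝ≥0∞)) := .of_discrete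
  have hX : Measurable (covariate : FullData 𝒳 𝒜 k → 𝒳) := measurable_covariate
  have hYa := measurable_potential_apply (𝒳 := 𝒳) (k := k) a
  have hA : Measurable (treatment : FullData 𝒳 𝒜 k → 𝒜) := measurable_treatment
  have hV : Measurable (confounders : FullData 𝒳 𝒜 k → _) := measurable_confounders
  have hY : Measurable (potential : FullData 𝒳 𝒜 k → _) := measurable_potential
  set G : ((𝒳 × (Fin k → ℝ)) × (𝒜 → ℝ)) × 𝒜 → ℝ≥0∞ :=
    fun p => ({a} : Set 𝒜).indicator 1 p.2 * f (p.1.1.1, p.1.2 a) with hG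
  have hGm : Measurable G := by fun_prop
  have key := congrArg (fun m => ∫⁻ p, G p ∂m) ((condIndepFun_iff_map_eq_compProd Q).1 hci.condIndep)
  rw [Measure.lintegral_compProd hGm, lintegral_map hGm (by fun_prop),
    lintegral_map (hGm.lintegral_kernel_prod_right') (by fun_prop)] at key
  rw [← lintegral_observed_treated P a hf, ← hQ,
    lintegral_map (by fun_prop) measurable_observe]
  calc _ = ∫⁻ ω, ∫⁻ b, G ((confounders ω, potential ω), b)
        ∂((condDistrib treatment confounders (Q : Measure (FullData 𝒳 𝒜 k))).prodMkRight _)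
          (confounders ω, potential ω) ∂(Q : Measure (FullData 𝒳 𝒜 k)) := by
        refine lintegral_congr fun ω => ?_
        simp only [hG, Kernel.prodMkRight_apply]
        rw [lintegral_mul_const _ hi, lintegral_indicator_one (measurableSet_singleton a),
          trueProp, measureReal_def, ENNReal.ofReal_toReal (measure_ne_top _ _)]
        rfl
    _ = ∫⁻ ω, G ((confounders ω, potential ω), treatment ω) ∂(Q : Measure (FullData 𝒳 𝒜 k)) :=
        key.symm
    _ = _ := by
        refine lintegral_congr fun ω => ?_
        by_cases h : treatment ω = a
        · simp [hG, observe, h]; rfl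
        · simp [hG, observe, h]

/-- The conditional law of `Y(a)` given `X` lies between two multiples of the conditional law of
`Y` given `X` and `A = a`. -/
theorem ae_potentialLaw_bounds (hΛ : 1 ≤ Λ) (hQ : Q ∈ uncertaintySet k Λ P) (a : 𝒜) :
    ∀ᵐ x ∂covariateLaw P,
      potentialLaw Q a x ≤
        ENNReal.ofReal (prop P a x + Λ * (1 - prop P a x)) • outcomeKernel P a x ∧
      ENNReal.ofReal (prop P a x + (1 - prop P a x) / Λ) • outcomeKernel P a x ≤
        potentialLaw Q a x := by
  obtain ⟨hM, hP⟩ := hQ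
  have hΛ0 : 0 < Λ := by linarith
  set e : 𝒳 → ℝ := prop P a with he
  have hem : Measurable e := measurable_prop P a
  have he0 : ∀ x, 0 ≤ e x := prop_nonneg P a
  have he1 : ∀ x, e x ≤ 1 := prop_le_one P a
  set u : 𝒳 → ℝ := fun x => e x + Λ * (1 - e x) with hu
  set l : 𝒳 → ℝ := fun x => e x + (1 - e x) / Λ with hl
  have hum : Measurable u := by fun_prop
  have hlm : Measurable l := by fun_prop
  have hu0 : ∀ x, 0 ≤ u x := fun x =>
    add_nonneg (he0 x) (mul_nonneg hΛ0.le (sub_nonneg.2 (he1 x)))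
  have hl0 : ∀ x, 0 ≤ l x := fun x =>
    add_nonneg (he0 x) (div_nonneg (sub_nonneg.2 (he1 x)) hΛ0.le)
  have huΛ : ∀ x, u x ≤ Λ := fun x => by
    have := he0 x; have := he1 x; simp only [hu]; nlinarith
  have hl1 : ∀ x, l x ≤ 1 := fun x => by
    have := div_le_self (sub_nonneg.2 (he1 x)) hΛ
    simp only [hl]; linarith
  have hprod : ∀ (c : 𝒳 → ℝ) (C : ℝ), (∀ x, c x ≤ C) → 0 ≤ C →
      IsFiniteKernel (scaleKernel (fun x => ENNReal.ofReal (c x * e x)) (outcomeKernel P a)) := by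
    intro c C hc hC
    refine isFiniteKernel_scaleKernel (C := ENNReal.ofReal C) ENNReal.ofReal_ne_top
      (fun x => ENNReal.ofReal_le_ofReal ?_) _
    have := he0 x; have := he1 x; have := hc x
    nlinarith
  have := hprod u Λ huΛ hΛ0.le
  have := hprod l 1 hl1 zero_le_one
  have := isFiniteKernel_scaleKernel (C := 1) (by simp)
    (fun x => ENNReal.ofReal_le_one.2 (he1 x)) (potentialLaw Q a)
  have hleft : ∀ D, MeasurableSet D → (covariateLaw P ⊗ₘ
      scaleKernel (fun x => ENNReal.ofReal (e x)) (potentialLaw Q a)) D =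
      ∫⁻ ω, ENNReal.ofReal (e (covariate ω)) * D.indicator 1 (covariate ω, potential ω a)
        ∂(Q : Measure (FullData 𝒳 𝒜 k)) := by
    intro D hD
    have hD' : Measurable (D.indicator (1 : 𝒳 × ℝ → ℝ≥0∞)) := measurable_one.indicator hD
    have hg : Measurable fun p : 𝒳 × ℝ => ENNReal.ofReal (e p.1) * D.indicator 1 p := by fun_prop
    rw [compProd_scaleKernel_apply _ (by fun_prop) _ hD, ← Measure.lintegral_compProd hg,
      ← map_covariate_potential_eq hP a, lintegral_map hg
        (measurable_covariate.prodMk (measurable_potential_apply a))]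
  have hright : ∀ c : 𝒳 → ℝ, Measurable c → (∀ x, 0 ≤ c x) →
      IsFiniteKernel (scaleKernel (fun x => ENNReal.ofReal (c x * e x)) (outcomeKernel P a)) →
      ∀ D, MeasurableSet D → (covariateLaw P ⊗ₘ
      scaleKernel (fun x => ENNReal.ofReal (c x * e x)) (outcomeKernel P a)) D =
      ∫⁻ ω, ENNReal.ofReal (c (covariate ω) * trueProp Q a (confounders ω)) *
        D.indicator 1 (covariate ω, potential ω a) ∂(Q : Measure (FullData 𝒳 𝒜 k)) := by
    intro c hc hc0 _ D hD
    have hD' : Measurable (D.indicator (1 : 𝒳 × ℝ → ℝ≥0∞)) := measurable_one.indicator hD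
    have hg : Measurable fun p : 𝒳 × ℝ => ENNReal.ofReal (c p.1) * D.indicator 1 p := by fun_prop
    have h := lintegral_trueProp_mul hM hP a hg
    rw [compProd_scaleKernel_apply _ (by fun_prop) _ hD]
    calc _ = _ := by
            refine lintegral_congr fun x => lintegral_congr fun y => ?_
            rw [mul_comm (c x), ENNReal.ofReal_mul (he0 x), mul_assoc]
      _ = _ := h.symm
      _ = _ := by
            refine lintegral_congr fun ω => ?_
            rw [mul_comm (c _), ENNReal.ofReal_mul
              (show 0 ≤ trueProp Q a (confounders ω) from measureReal_nonneg), mul_assoc]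
  have hb := hM.ae_bounds hΛ hP a
  -- The pointwise bound `e ≤ u p` is integrated over events in `(X, Y(a))`. The identity for the
  -- true propensity carries a factor `e`, so both sides do; it is cancelled at the end, where `e >
  -- 0`.
  have hU : covariateLaw P ⊗ₘ scaleKernel (fun x => ENNReal.ofReal (e x)) (potentialLaw Q a) ≤
      covariateLaw P ⊗ₘ
        scaleKernel (fun x => ENNReal.ofReal (u x * e x)) (outcomeKernel P a) := by
    refine Measure.le_iff.2 fun D hD => ?_
    rw [hleft D hD, hright u hum hu0 inferInstance D hD]
    refine lintegral_mono_ae ?_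
    filter_upwards [hb] with ω hω
    gcongr
    exact hω.2.1
  have hL : covariateLaw P ⊗ₘ
        scaleKernel (fun x => ENNReal.ofReal (l x * e x)) (outcomeKernel P a) ≤
      covariateLaw P ⊗ₘ scaleKernel (fun x => ENNReal.ofReal (e x)) (potentialLaw Q a) := by
    refine Measure.le_iff.2 fun D hD => ?_
    rw [hleft D hD, hright l hlm hl0 inferInstance D hD]
    refine lintegral_mono_ae ?_
    filter_upwards [hb] with ω hω
    gcongr
    exact hω.2.2
  filter_upwards [ae_le_of_compProd_le hU, ae_le_of_compProd_le hL,
    hM.ae_prop_mem_Ioo hΛ hP a] with x h1 h2 h3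
  rw [scaleKernel_apply (by fun_prop), scaleKernel_apply (by fun_prop)] at h1 h2
  have hx0 : ENNReal.ofReal (e x) ≠ 0 := (ENNReal.ofReal_pos.2 h3.1).ne'
  have hcancel : ∀ {r s : ℝ≥0∞}, ENNReal.ofReal (e x) * r ≤ ENNReal.ofReal (e x) * s → r ≤ s :=
    fun h => (ENNReal.mul_le_mul_iff_right hx0 ENNReal.ofReal_ne_top).1 h
  constructor
  · refine Measure.le_iff.2 fun s _ => hcancel ?_
    have := h1 s
    rw [mul_comm (u x), ENNReal.ofReal_mul (he0 x)] at this
    simpa [mul_assoc] using this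
  · refine Measure.le_iff.2 fun s _ => hcancel ?_
    have := h2 s
    rw [mul_comm (l x), ENNReal.ofReal_mul (he0 x)] at this
    simpa [mul_assoc] using this

end UncertaintySet

/-- In the observed data, `Y` is integrable given `X = x` and `A = a` when `Y` is integrable. -/
theorem ae_integrable_outcomeKernel {P : ProbabilityMeasure (ObsData 𝒳 𝒜)}
    (hY : Integrable (fun z => z.2.1) (P : Measure (ObsData 𝒳 𝒜))) (a : 𝒜)
    (hpos : ∀ᵐ x ∂covariateLaw P, 0 < prop P a x) :
    ∀ᵐ x ∂covariateLaw P, Integrable (fun y : ℝ => y) (outcomeKernel P a x) := by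
  have hf : Measurable fun p : 𝒳 × ℝ => ‖p.2‖ₑ := by fun_prop
  have hfin : ∫⁻ x, ∫⁻ y, ENNReal.ofReal (prop P a x) * ‖y‖ₑ ∂outcomeKernel P a x
      ∂covariateLaw P ≠ ∞ := by
    rw [← lintegral_observed_treated P a hf]
    refine ne_top_of_le_ne_top hY.2.ne (lintegral_mono fun z => ?_)
    by_cases h : z.2.2 = a <;> simp [h]
  have hm : Measurable fun x => ∫⁻ y, ENNReal.ofReal (prop P a x) * ‖y‖ₑ ∂outcomeKernel P a x :=
    Measurable.lintegral_kernel_prod_right' (κ := outcomeKernel P a)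
      (f := fun p : 𝒳 × ℝ => ENNReal.ofReal (prop P a p.1) * ‖p.2‖ₑ) (by fun_prop)
  filter_upwards [ae_lt_top hm hfin, hpos] with x hx hx0
  refine ⟨by fun_prop, ?_⟩
  rw [lintegral_const_mul _ (by fun_prop)] at hx
  rw [hasFiniteIntegral_iff_enorm]
  by_contra! htop
  rw [top_le_iff] at htop
  rw [htop, ENNReal.mul_top (ENNReal.ofReal_pos.2 hx0).ne'] at hx
  exact lt_irrefl _ hx

end

/-! ### Conditional independence from a prescribed treatment kernel -/

section

/-- Serves both to forget the potential outcomes and to pass from `(X, Y(a), Z)` to confounders and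
potential outcomes. -/
theorem map_compProd_comap {E V β : Type*} [MeasurableSpace E] [MeasurableSpace V]
    [MeasurableSpace β] (m : Measure E) [SFinite m] (κ : Kernel V β) [IsSFiniteKernel κ]
    {g : E → V} (hg : Measurable g) :
    (m ⊗ₘ κ.comap g hg).map (Prod.map g id) = m.map g ⊗ₘ κ := by
  have hgi : Measurable (Prod.map g (id : β → β)) := hg.prodMap measurable_id
  ext D hD
  rw [Measure.map_apply hgi hD, Measure.compProd_apply (hgi hD), Measure.compProd_apply hD,
    lintegral_map (Kernel.measurable_kernel_prodMk_left hD) hg]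
  rfl

variable {𝒳 𝒜 : Type*} [MeasurableSpace 𝒳]
  [Finite 𝒜] [Nonempty 𝒜] [MeasurableSpace 𝒜] [MeasurableSingletonClass 𝒜] {k : ℕ}

/-- A kernel that gives the treatment from the confounders, independently of the potential
outcomes, is the conditional law of the treatment given the confounders. -/
theorem condDistrib_ae_eq_of_map_eq_compProd {Q : ProbabilityMeasure (FullData 𝒳 𝒜 k)}
    {η : Kernel (𝒳 × (Fin k → ℝ)) 𝒜} [IsMarkovKernel η]
    (h : (Q : Measure (FullData 𝒳 𝒜 k)).map
        (fun ω => ((confounders ω, potential ω), treatment ω)) =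
      ((Q : Measure (FullData 𝒳 𝒜 k)).map fun ω => (confounders ω, potential ω)) ⊗ₘ
        η.prodMkRight _) :
    condDistrib treatment confounders (Q : Measure (FullData 𝒳 𝒜 k))
      =ᵐ[(Q : Measure (FullData 𝒳 𝒜 k)).map confounders] η := by
  have hV : Measurable (confounders : FullData 𝒳 𝒜 k → _) := measurable_confounders
  have hY : Measurable (potential : FullData 𝒳 𝒜 k → _) := measurable_potential
  have hA : Measurable (treatment : FullData 𝒳 𝒜 k → 𝒜) := measurable_treatment
  refine condDistrib_ae_eq_of_measure_eq_compProd _ hA.aemeasurable ?_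
  have h1 := congrArg (Measure.map (Prod.map Prod.fst id)) h
  rw [Measure.map_map (by fun_prop) (by fun_prop), Kernel.prodMkRight,
    map_compProd_comap _ η measurable_fst, Measure.map_map (by fun_prop) (by fun_prop)] at h1
  exact h1

/-- Forgetting the potential outcomes shows that `η` is a version of the conditional law of the
treatment; a change of version does not affect the composition product. -/
theorem condIndepFun_of_map_eq_compProd [StandardBorelSpace 𝒳]
    {Q : ProbabilityMeasure (FullData 𝒳 𝒜 k)}
    {η : Kernel (𝒳 × (Fin k → ℝ)) 𝒜} [IsMarkovKernel η]
    (h : (Q : Measure (FullData 𝒳 𝒜 k)).map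
        (fun ω => ((confounders ω, potential ω), treatment ω)) =
      ((Q : Measure (FullData 𝒳 𝒜 k)).map fun ω => (confounders ω, potential ω)) ⊗ₘ
        η.prodMkRight _) :
    CondIndepFun (MeasurableSpace.comap confounders inferInstance)
      (Measurable.comap_le measurable_confounders) potential treatment
      (Q : Measure (FullData 𝒳 𝒜 k)) := by
  have hV : Measurable (confounders : FullData 𝒳 𝒜 k → _) := measurable_confounders
  have hY : Measurable (potential : FullData 𝒳 𝒜 k → _) := measurable_potential
  rw [condIndepFun_iff_map_eq_compProd, h]
  refine Measure.compProd_congr ?_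
  have h1 := condDistrib_ae_eq_of_map_eq_compProd h
  have h2 : (Q : Measure (FullData 𝒳 𝒜 k)).map confounders =
      ((Q : Measure (FullData 𝒳 𝒜 k)).map fun ω => (confounders ω, potential ω)).map
        Prod.fst := by
    rw [Measure.map_map (by fun_prop) (by fun_prop)]
    rfl
  rw [h2] at h1
  filter_upwards [ae_of_ae_map (by fun_prop) h1] with w hw using by
    rw [Kernel.prodMkRight_apply, Kernel.prodMkRight_apply]
    exact hw.symm

/-! ### Realising a weight by a full-data distribution -/

section Construction

open Classical in
/-- The density of the law of `Y(a)` given `X` and `A = b` with respect to the law of `Y` given `X`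
and `A = a`, in the distribution constructed from the weight `lam`. -/
def armDensity (a : 𝒜) (lam : 𝒳 × ℝ → ℝ) (p : 𝒳 × ℝ) (b : 𝒜) : ℝ≥0∞ :=
  if b = a then 1 else ENNReal.ofReal (lam p)

/-- The density of the law of `Y(a)` given `X` with respect to the law of `Y` given `X` and
`A = a`. -/
def mixDensity (P : ProbabilityMeasure (ObsData 𝒳 𝒜)) (a : 𝒜) (lam : 𝒳 × ℝ → ℝ) (p : 𝒳 × ℝ) :
    ℝ :=
  prop P a p.1 + (1 - prop P a p.1) * lam p

/-- The conditional law of the treatment given `X` and `Y(a)`. -/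
def armKernel (P : ProbabilityMeasure (ObsData 𝒳 𝒜)) (a : 𝒜) (lam : 𝒳 × ℝ → ℝ) :
    Kernel (𝒳 × ℝ) 𝒜 :=
  ((treatmentKernel P).comap Prod.fst measurable_fst).withDensity
    fun p b => armDensity a lam p b / ENNReal.ofReal (mixDensity P a lam p)

variable {P : ProbabilityMeasure (ObsData 𝒳 𝒜)} {a : 𝒜} {lam : 𝒳 × ℝ → ℝ}

theorem measurable_armDensity (hlam : Measurable lam) :
    Measurable (Function.uncurry (armDensity a lam) : (𝒳 × ℝ) × 𝒜 → ℝ≥0∞) := by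
  unfold armDensity Function.uncurry
  exact Measurable.ite (measurable_snd (measurableSet_singleton a)) measurable_const
    (by fun_prop)

theorem measurable_mixDensity (hlam : Measurable lam) : Measurable (mixDensity P a lam) := by
  unfold mixDensity
  fun_prop

theorem mixDensity_pos (hpos : ∀ p, 0 < lam p) (p : 𝒳 × ℝ) : 0 < mixDensity P a lam p := by
  have h0 := prop_nonneg P a p.1
  have h1 := prop_le_one P a p.1
  have := hpos p
  unfold mixDensity
  rcases h0.eq_or_lt with h | h
  · rw [← h]; simpa using this
  · have := mul_nonneg (sub_nonneg.2 h1) this.le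
    linarith

/-- This is the normalising constant that makes `armKernel` a probability kernel. -/
theorem lintegral_armDensity (hpos : ∀ p, 0 < lam p) (p : 𝒳 × ℝ) :
    ∫⁻ b, armDensity a lam p b ∂treatmentKernel P p.1 = ENNReal.ofReal (mixDensity P a lam p) := by
  have h : armDensity a lam p = fun b => ({a} : Set 𝒜).indicator (fun _ => 1) b +
      ({a}ᶜ : Set 𝒜).indicator (fun _ => ENNReal.ofReal (lam p)) b := by
    funext b
    by_cases hb : b = a <;> simp [armDensity, hb]
  have hc : treatmentKernel P p.1 {a}ᶜ = ENNReal.ofReal (1 - prop P a p.1) := by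
    rw [prob_compl_eq_one_sub (measurableSet_singleton a), treatmentKernel_singleton,
      ENNReal.ofReal_sub _ (prop_nonneg P a _), ENNReal.ofReal_one]
  have h1 := prop_le_one P a p.1
  rw [h, lintegral_add_left .of_discrete, lintegral_indicator_const (measurableSet_singleton a),
    lintegral_indicator_const (measurableSet_singleton a).compl, treatmentKernel_singleton, hc,
    one_mul, mul_comm, mixDensity, ENNReal.ofReal_add (prop_nonneg P a _)
      (mul_nonneg (sub_nonneg.2 h1) (hpos p).le), ENNReal.ofReal_mul (sub_nonneg.2 h1)]

theorem measurable_armDensity_div (hlam : Measurable lam) :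
    Measurable (Function.uncurry fun (p : 𝒳 × ℝ) (b : 𝒜) =>
      armDensity a lam p b / ENNReal.ofReal (mixDensity P a lam p)) :=
  (measurable_armDensity hlam).div
    ((measurable_mixDensity hlam).comp measurable_fst).ennreal_ofReal

theorem armKernel_apply (hlam : Measurable lam) (p : 𝒳 × ℝ) :
    armKernel P a lam p = (treatmentKernel P p.1).withDensity
      fun b => armDensity a lam p b / ENNReal.ofReal (mixDensity P a lam p) := by
  rw [armKernel, Kernel.withDensity_apply _ (measurable_armDensity_div hlam)]
  rfl

theorem isMarkovKernel_armKernel (hlam : Measurable lam) (hpos : ∀ p, 0 < lam p) :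
    IsMarkovKernel (armKernel P a lam) := by
  refine ⟨fun p => ⟨?_⟩⟩
  have h0 : ENNReal.ofReal (mixDensity P a lam p) ≠ 0 :=
    (ENNReal.ofReal_pos.2 (mixDensity_pos hpos p)).ne'
  rw [armKernel_apply hlam, withDensity_apply _ .univ, Measure.restrict_univ]
  simp only [div_eq_mul_inv]
  rw [lintegral_mul_const _ .of_discrete, lintegral_armDensity hpos,
    ENNReal.mul_inv_cancel h0 ENNReal.ofReal_ne_top]

theorem armKernel_real_singleton (hlam : Measurable lam) (hpos : ∀ p, 0 < lam p) (p : 𝒳 × ℝ)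
    (b : 𝒜) : (armKernel P a lam p).real {b} =
      prop P b p.1 * (armDensity a lam p b).toReal / mixDensity P a lam p := by
  rw [measureReal_def, armKernel_apply hlam, withDensity_apply _ (measurableSet_singleton b),
    lintegral_singleton, ENNReal.toReal_mul, ENNReal.toReal_div,
    ENNReal.toReal_ofReal (mixDensity_pos hpos p).le, treatmentKernel_singleton,
    ENNReal.toReal_ofReal (prop_nonneg P b _)]
  ring

/-- The conditional law of `Y(a)` given `X` in the distribution constructed from `lam`. -/
def mixKernel (P : ProbabilityMeasure (ObsData 𝒳 𝒜)) (a : 𝒜) (lam : 𝒳 × ℝ → ℝ) : Kernel 𝒳 ℝ :=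
  (outcomeKernel P a).withDensity fun x y => ENNReal.ofReal (mixDensity P a lam (x, y))

theorem mixKernel_apply (hlam : Measurable lam) (x : 𝒳) :
    mixKernel P a lam x = (outcomeKernel P a x).withDensity
      fun y => ENNReal.ofReal (mixDensity P a lam (x, y)) := by
  rw [mixKernel, Kernel.withDensity_apply _ (measurable_mixDensity hlam).ennreal_ofReal]

theorem isMarkovKernel_mixKernel (hlam : Measurable lam) (hpos : ∀ p, 0 < lam p)
    (hint : ∀ x, ∫⁻ y, ENNReal.ofReal (lam (x, y)) ∂outcomeKernel P a x = 1) :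
    IsMarkovKernel (mixKernel P a lam) := by
  refine ⟨fun x => ⟨?_⟩⟩
  have h0 := prop_nonneg P a x
  have h1 := sub_nonneg.2 (prop_le_one P a x)
  rw [mixKernel_apply hlam, withDensity_apply _ .univ, Measure.restrict_univ]
  calc ∫⁻ y, ENNReal.ofReal (mixDensity P a lam (x, y)) ∂outcomeKernel P a x
      = ∫⁻ y, (ENNReal.ofReal (prop P a x) +
          ENNReal.ofReal (1 - prop P a x) * ENNReal.ofReal (lam (x, y))) ∂outcomeKernel P a x := by
        refine lintegral_congr fun y => ?_
        rw [mixDensity, ENNReal.ofReal_add h0 (mul_nonneg h1 (hpos _).le), ENNReal.ofReal_mul h1]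
    _ = 1 := by
        rw [lintegral_add_left measurable_const, lintegral_const_mul _ (by fun_prop), hint,
          lintegral_const, measure_univ, mul_one, mul_one, ← ENNReal.ofReal_add h0 h1]
        simp

/-- The law of `(X, Y(a), Z)`, where `Z` is a vector of outcomes with kernel `H`. -/
def outcomeMeasure (P : ProbabilityMeasure (ObsData 𝒳 𝒜)) (a : 𝒜) (lam : 𝒳 × ℝ → ℝ)
    (H : Kernel 𝒳 (𝒜 → ℝ)) : Measure (𝒳 × ℝ × (𝒜 → ℝ)) :=
  covariateLaw P ⊗ₘ (mixKernel P a lam ×ₖ H)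

/-- The law of `((X, Y(a), Z), A)`. -/
def jointMeasure (P : ProbabilityMeasure (ObsData 𝒳 𝒜)) (a : 𝒜) (lam : 𝒳 × ℝ → ℝ)
    (H : Kernel 𝒳 (𝒜 → ℝ)) : Measure ((𝒳 × ℝ × (𝒜 → ℝ)) × 𝒜) :=
  outcomeMeasure P a lam H ⊗ₘ
    (armKernel P a lam).comap (fun w => (w.1, w.2.1)) (by fun_prop)

/-- Bayes' rule: the density `mixDensity` of `Y(a)` cancels the denominator of the treatment kernel.
The treatment is then drawn first, with its nominal law, and `Y(a)` afterwards with density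
`armDensity`. -/
theorem lintegral_jointMeasure (hlam : Measurable lam) (hpos : ∀ p, 0 < lam p)
    (hint : ∀ x, ∫⁻ y, ENNReal.ofReal (lam (x, y)) ∂outcomeKernel P a x = 1)
    (H : Kernel 𝒳 (𝒜 → ℝ)) [IsMarkovKernel H]
    {f : (𝒳 × ℝ × (𝒜 → ℝ)) × 𝒜 → ℝ≥0∞} (hf : Measurable f) :
    ∫⁻ w, f w ∂jointMeasure P a lam H =
      ∫⁻ x, ∫⁻ b, ∫⁻ y, armDensity a lam (x, y) b * ∫⁻ z, f ((x, y, z), b) ∂H x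
        ∂outcomeKernel P a x ∂treatmentKernel P x ∂covariateLaw P := by
  have := isMarkovKernel_mixKernel hlam hpos hint
  have := isMarkovKernel_armKernel (P := P) (a := a) hlam hpos
  have : IsProbabilityMeasure (outcomeMeasure P a lam H) := by
    unfold outcomeMeasure; infer_instance
  have hr := measurable_armDensity (a := a) hlam
  have hN := measurable_mixDensity (P := P) (a := a) hlam
  have hF : Measurable fun w : 𝒳 × ℝ × (𝒜 → ℝ) =>
      ∫⁻ b, f (w, b) ∂((armKernel P a lam).comap (fun w : 𝒳 × ℝ × (𝒜 → ℝ) => (w.1, w.2.1))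
        (by fun_prop)) w := Measurable.lintegral_kernel_prod_right' hf
  rw [jointMeasure, Measure.lintegral_compProd hf, outcomeMeasure,
    Measure.lintegral_compProd hF]
  refine lintegral_congr fun x => ?_
  have hFx : Measurable fun w : ℝ × (𝒜 → ℝ) =>
      ∫⁻ b, f ((x, w), b) ∂((armKernel P a lam).comap (fun w : 𝒳 × ℝ × (𝒜 → ℝ) => (w.1, w.2.1))
        (by fun_prop)) (x, w) := hF.comp measurable_prodMk_left
  have hI : Measurable fun y => ∫⁻ z, ∫⁻ b, f ((x, y, z), b) ∂armKernel P a lam (x, y) ∂H x :=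
    hFx.lintegral_prod_right'
  have hfz : Measurable fun p : (ℝ × 𝒜) × (𝒜 → ℝ) => f ((x, p.1.1, p.2), p.1.2) := by fun_prop
  have hfz' : Measurable fun p : ℝ × 𝒜 => ∫⁻ z, f ((x, p.1, z), p.2) ∂H x :=
    hfz.lintegral_prod_right'
  have hrx : Measurable fun p : ℝ × 𝒜 => armDensity a lam (x, p.1) p.2 :=
    hr.comp (by fun_prop : Measurable fun p : ℝ × 𝒜 => ((x, p.1), p.2))
  have hNx : Measurable fun y => ENNReal.ofReal (mixDensity P a lam (x, y)) := by fun_prop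
  rw [Kernel.prod_apply, lintegral_prod _ hFx.aemeasurable]
  simp only [Kernel.comap_apply]
  rw [mixKernel_apply hlam, lintegral_withDensity_eq_lintegral_mul _ hNx hI,
    lintegral_lintegral_swap (hrx.mul hfz').aemeasurable |>.symm]
  refine lintegral_congr fun y => ?_
  have h0 : ENNReal.ofReal (mixDensity P a lam (x, y)) ≠ 0 :=
    (ENNReal.ofReal_pos.2 (mixDensity_pos hpos _)).ne'
  have hfy : Measurable fun p : (𝒜 → ℝ) × 𝒜 => f ((x, y, p.1), p.2) := by fun_prop
  simp only [Pi.mul_apply, armKernel_apply hlam]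
  have hin : ∀ z, ∫⁻ b, f ((x, y, z), b) ∂(treatmentKernel P x).withDensity
      (fun b => armDensity a lam (x, y) b / ENNReal.ofReal (mixDensity P a lam (x, y))) =
      (ENNReal.ofReal (mixDensity P a lam (x, y)))⁻¹ *
        ∫⁻ b, armDensity a lam (x, y) b * f ((x, y, z), b) ∂treatmentKernel P x := by
    intro z
    rw [lintegral_withDensity_eq_lintegral_mul _ .of_discrete .of_discrete,
      ← lintegral_const_mul _ .of_discrete]
    refine lintegral_congr fun b => ?_
    simp only [Pi.mul_apply, div_eq_mul_inv]
    ring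
  have hry : Measurable fun p : (𝒜 → ℝ) × 𝒜 => armDensity a lam (x, y) p.2 * f ((x, y, p.1), p.2) :=
    (hrx.comp (by fun_prop : Measurable fun p : (𝒜 → ℝ) × 𝒜 => (y, p.2))).mul hfy
  simp only [hin]
  rw [lintegral_const_mul _ hry.lintegral_prod_right', ← mul_assoc,
    ENNReal.mul_inv_cancel h0 ENNReal.ofReal_ne_top, one_mul,
    lintegral_lintegral_swap hry.aemeasurable]
  refine lintegral_congr fun b => ?_
  change ∫⁻ z, armDensity a lam (x, y) b * f ((x, y, z), b) ∂H x = _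
  rw [lintegral_const_mul _ (by fun_prop)]

/-- The full data `(X, (Y(a))_a, A, U)` with `Y(a)` in place of the `a`-th coordinate of `Z` and
with all coordinates of `U` equal to `Y(a)`. -/
def toFullData (k : ℕ) (a : 𝒜) (w : (𝒳 × ℝ × (𝒜 → ℝ)) × 𝒜) : FullData 𝒳 𝒜 k :=
  open Classical in (w.1.1, Function.update w.1.2.2 a w.1.2.1, w.2, fun _ => w.1.2.1)

theorem measurable_toFullData : Measurable (toFullData k a : _ → FullData 𝒳 𝒜 k) := by
  unfold toFullData
  fun_prop

/-- On `A = a` the density is one and `Y = Y(a)`. On `A = b ≠ a` the outcome is `Z b`, independent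
of `Y(a)` given `X` and `A`, so `lam` integrates out to one. -/
theorem map_observe_jointMeasure (hlam : Measurable lam) (hpos : ∀ p, 0 < lam p)
    (hint : ∀ x, ∫⁻ y, ENNReal.ofReal (lam (x, y)) ∂outcomeKernel P a x = 1)
    (H : Kernel 𝒳 (𝒜 → ℝ)) [IsMarkovKernel H]
    (hH : ∀ b x, (H x).map (fun z => z b) = outcomeKernel P b x) :
    ((jointMeasure P a lam H).map (toFullData k a)).map observe =
      (P : Measure (ObsData 𝒳 𝒜)) := by
  refine Measure.ext_of_lintegral _ fun f hf => ?_
  have ht := measurable_toFullData (𝒳 := 𝒳) (a := a) (k := k)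
  have hfo : Measurable fun ω : FullData 𝒳 𝒜 k => f (observe ω) := hf.comp measurable_observe
  have hfot : Measurable fun w => f (observe (toFullData k a w)) := hfo.comp ht
  rw [lintegral_map hf measurable_observe, lintegral_map hfo ht,
    lintegral_jointMeasure hlam hpos hint H hfot, lintegral_observed P hf]
  refine lintegral_congr fun x => lintegral_congr fun b => ?_
  by_cases hb : b = a
  · subst hb
    simp [armDensity, toFullData, observe, covariate, potential, treatment]
  · have h1 : ∀ y, ∫⁻ z, f (observe (toFullData k a ((x, y, z), b))) ∂H x =
        ∫⁻ y, f (x, y, b) ∂outcomeKernel P b x := by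
      intro y
      rw [← hH b x, lintegral_map (by fun_prop) (measurable_pi_apply b)]
      simp [toFullData, observe, covariate, potential, treatment, hb]
    simp only [h1, armDensity, hb, if_false]
    rw [lintegral_mul_const _ (by fun_prop), hint, one_mul]

/-- The odds ratio is exactly `1 / l`. -/
theorem odds_ratio_mem_Icc {Λ e l : ℝ} (hΛ : 1 ≤ Λ) (he0 : 0 < e) (he1 : e < 1)
    (hl : l ∈ Set.Icc (1 / Λ) Λ) :
    odds (e / (e + (1 - e) * l)) / odds e ∈ Set.Icc (1 / Λ) Λ := by
  have hΛ0 : 0 < Λ := by linarith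
  have hl0 : 0 < l := lt_of_lt_of_le (by positivity) hl.1
  have he1' : 0 < 1 - e := by linarith
  have hD : 0 < e + (1 - e) * l := by positivity
  have h1 : 1 - e / (e + (1 - e) * l) = (1 - e) * l / (e + (1 - e) * l) := by
    field_simp; ring
  have : odds (e / (e + (1 - e) * l)) / odds e = 1 / l := by
    unfold odds
    rw [h1]; field_simp
  rw [this]
  have h2 := (div_le_iff₀ hΛ0).1 hl.1
  constructor
  · exact one_div_le_one_div_of_le hl0 hl.2
  · rw [div_le_iff₀ hl0]; linarith

/-- With `s = 1 - e - b` the mass of the remaining levels, the odds ratio is `l * (e + s) / (e + s *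
l)`, which lies between `1` and `l`. -/
theorem odds_ratio_mem_Icc_of_ne {Λ e b l : ℝ} (hΛ : 1 ≤ Λ) (he0 : 0 < e) (hb0 : 0 < b)
    (hb1 : b < 1) (heb : e + b ≤ 1) (hl : l ∈ Set.Icc (1 / Λ) Λ) :
    odds (b * l / (e + (1 - e) * l)) / odds b ∈ Set.Icc (1 / Λ) Λ := by
  have hΛ0 : 0 < Λ := by linarith
  have hl0 : 0 < l := lt_of_lt_of_le (by positivity) hl.1
  obtain ⟨s, hs⟩ : ∃ s, s = 1 - e - b := ⟨_, rfl⟩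
  have hs0 : 0 ≤ s := by linarith
  have hb' : 1 - b = e + s := by linarith
  have he' : 1 - e = s + b := by linarith
  have hsl : 0 ≤ s * l := by positivity
  have hD : 0 < e + (s + b) * l := by positivity
  have hD' : 0 < e + s * l := by positivity
  have h1 : 1 - b * l / (e + (s + b) * l) = (e + s * l) / (e + (s + b) * l) := by
    field_simp; ring
  have : odds (b * l / (e + (1 - e) * l)) / odds b = l * (e + s) / (e + s * l) := by
    unfold odds
    rw [he', h1, hb']; field_simp
  have h2 := (div_le_iff₀ hΛ0).1 hl.1
  rw [this, Set.mem_Icc, div_le_div_iff₀ hΛ0 hD', div_le_iff₀ hD']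
  constructor
  · nlinarith [mul_nonneg hsl (sub_nonneg.2 hΛ)]
  · nlinarith [mul_nonneg hsl (sub_nonneg.2 hΛ), mul_le_mul_of_nonneg_right hl.2 he0.le]

theorem prop_add_prop_le_one {a b : 𝒜} (hab : b ≠ a) (x : 𝒳) :
    prop P a x + prop P b x ≤ 1 := by
  have h : (treatmentKernel P x).real ({a} ∪ {b}) =
      (treatmentKernel P x).real {a} + (treatmentKernel P x).real {b} :=
    measureReal_union (by simpa using hab.symm) (measurableSet_singleton b)
  calc prop P a x + prop P b x = (treatmentKernel P x).real ({a} ∪ {b}) := h.symm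
    _ ≤ 1 := measureReal_le_one

/-- Every weight `lam` with values in `[1 / Λ, Λ]` that integrates to one against the conditional
law of the outcome is realised by a distribution in the uncertainty set. -/
theorem exists_mem_uncertaintySet [StandardBorelSpace 𝒳] (hk : 1 ≤ k) {Λ : ℝ} (hΛ : 1 ≤ Λ)
    (hprop : ∀ b, ∀ᵐ x ∂covariateLaw P, 0 < prop P b x ∧ prop P b x < 1)
    (hlam : Measurable lam) (hmem : ∀ p, lam p ∈ Set.Icc (1 / Λ) Λ)
    (hint : ∀ x, ∫⁻ y, ENNReal.ofReal (lam (x, y)) ∂outcomeKernel P a x = 1) :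
    ∃ Q ∈ uncertaintySet k Λ P, potentialLaw Q a =ᵐ[covariateLaw P] mixKernel P a lam := by
  have hpos : ∀ p, 0 < lam p := fun p =>
    lt_of_lt_of_le (by have : 0 < Λ := by linarith
                       positivity) (hmem p).1
  obtain ⟨H, _, hH⟩ := exists_coupling (outcomeKernel P)
  have := isMarkovKernel_mixKernel hlam hpos hint
  have := isMarkovKernel_armKernel (P := P) (a := a) hlam hpos
  have : IsProbabilityMeasure (outcomeMeasure P a lam H) := by
    unfold outcomeMeasure; infer_instance
  have : IsProbabilityMeasure (jointMeasure P a lam H) := by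
    unfold jointMeasure; infer_instance
  have ht := measurable_toFullData (𝒳 := 𝒳) (a := a) (k := k)
  have hV : Measurable (confounders : FullData 𝒳 𝒜 k → _) := measurable_confounders
  have hX : Measurable (covariate : FullData 𝒳 𝒜 k → _) := measurable_covariate
  have hY : Measurable (potential : FullData 𝒳 𝒜 k → _) := measurable_potential
  have hYa := measurable_potential_apply (𝒳 := 𝒳) (k := k) a
  have hA : Measurable (treatment : FullData 𝒳 𝒜 k → 𝒜) := measurable_treatment
  let Q : ProbabilityMeasure (FullData 𝒳 𝒜 k) :=
    ⟨(jointMeasure P a lam H).map (toFullData k a), Measure.isProbabilityMeasure_map ht.aemeasurable⟩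
  have hQ : (Q : Measure (FullData 𝒳 𝒜 k)) = (jointMeasure P a lam H).map (toFullData k a) := rfl
  have hQP : (Q : Measure (FullData 𝒳 𝒜 k)).map observe = P :=
    map_observe_jointMeasure hlam hpos hint H hH
  -- Since `k ≥ 1`, the coordinate `0` of `U` exists and recovers `Y(a)`.
  let p : 𝒳 × (Fin k → ℝ) → 𝒳 × ℝ := fun v => (v.1, v.2 ⟨0, hk⟩)
  have hp : Measurable p := by fun_prop
  have hci : (Q : Measure (FullData 𝒳 𝒜 k)).map
        (fun ω => ((confounders ω, potential ω), treatment ω)) =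
      ((Q : Measure (FullData 𝒳 𝒜 k)).map fun ω => (confounders ω, potential ω)) ⊗ₘ
        ((armKernel P a lam).comap p hp).prodMkRight _ := by
    classical
    let g : 𝒳 × ℝ × (𝒜 → ℝ) → (𝒳 × (Fin k → ℝ)) × (𝒜 → ℝ) :=
      fun w => ((w.1, fun _ => w.2.1), Function.update w.2.2 a w.2.1)
    have hg : Measurable g := by fun_prop
    have h1 : (Q : Measure (FullData 𝒳 𝒜 k)).map (fun ω => (confounders ω, potential ω)) =
        (outcomeMeasure P a lam H).map g := by
      rw [hQ, Measure.map_map (by fun_prop) ht]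
      have : (fun ω : FullData 𝒳 𝒜 k => (confounders ω, potential ω)) ∘ toFullData k a =
          g ∘ Prod.fst := by
        funext w
        simp only [Function.comp_apply, confounders, potential, toFullData, g]
      rw [this, ← Measure.map_map hg measurable_fst, jointMeasure]
      congr 1
      exact Measure.fst_compProd _ _
    -- Reading `(X, Y(a))` off the confounders produced by `g` returns the original pair, so the
    -- treatment kernel factors through `g`.
    rw [h1, ← map_compProd_comap _ _ hg, hQ, Measure.map_map (by fun_prop) ht]
    have : (fun ω : FullData 𝒳 𝒜 k => ((confounders ω, potential ω), treatment ω)) ∘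
        toFullData k a = Prod.map g id := by
      funext w
      simp only [Function.comp_apply, confounders, potential, treatment, toFullData, g, Prod.map]
      congr!
    rw [this]
    rfl
  have hfinal : ∀ᵐ ω ∂(Q : Measure (FullData 𝒳 𝒜 k)), ∀ b : 𝒜,
      odds (trueProp Q b (confounders ω)) / odds (nominalProp Q b (covariate ω)) ∈
        Set.Icc (1 / Λ) Λ := by
    have h1 := ae_of_ae_map hV.aemeasurable (condDistrib_ae_eq_of_map_eq_compProd hci)
    have h2 : ∀ᵐ x ∂(Q : Measure (FullData 𝒳 𝒜 k)).map covariate,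
        ∀ b, 0 < prop P b x ∧ prop P b x < 1 := by
      rw [map_covariate_eq hQP]
      exact ae_all_iff.2 hprop
    filter_upwards [h1, ae_of_ae_map hX.aemeasurable h2] with ω hω hω' b
    rw [nominalProp_eq_prop hQP, trueProp, hω, Kernel.comap_apply,
      armKernel_real_singleton hlam hpos, mixDensity]
    change odds (prop P b (covariate ω) * _ /
      (prop P a (covariate ω) + (1 - prop P a (covariate ω)) * lam (p (confounders ω)))) / _ ∈ _
    by_cases hb : b = a
    · subst hb
      simpa [armDensity] using
        odds_ratio_mem_Icc hΛ (hω' b).1 (hω' b).2 (hmem (p (confounders ω)))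
    · rw [armDensity, if_neg hb, ENNReal.toReal_ofReal (hpos _).le]
      exact odds_ratio_mem_Icc_of_ne hΛ (hω' a).1 (hω' b).1 (hω' b).2
        (prop_add_prop_le_one hb _) (hmem _)
  refine ⟨Q, ⟨⟨condIndepFun_of_map_eq_compProd hci, hfinal⟩, hQP⟩, ?_⟩
  rw [← map_covariate_eq hQP]
  refine condDistrib_ae_eq_of_measure_eq_compProd _ hYa.aemeasurable ?_
  rw [map_covariate_eq hQP, hQ, Measure.map_map (by fun_prop) ht]
  have h1 : (fun ω : FullData 𝒳 𝒜 k => (covariate ω, potential ω a)) ∘ toFullData k a =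
      (Prod.map id Prod.fst) ∘ Prod.fst := by
    funext w
    simp [covariate, potential, toFullData]
    rfl
  have h2 : (jointMeasure P a lam H).map Prod.fst = outcomeMeasure P a lam H :=
    Measure.fst_compProd _ _
  rw [h1, ← Measure.map_map (by fun_prop) measurable_fst, h2, outcomeMeasure,
    ← Measure.compProd_map measurable_fst]
  congr 1
  exact (Kernel.fst_eq _).symm.trans (Kernel.fst_prod _ _)

end Construction

end

/-! ### Extremal weights -/

section

variable {𝒳 𝒜 : Type*} [MeasurableSpace 𝒳]
  [Finite 𝒜] [Nonempty 𝒜] [MeasurableSpace 𝒜] [MeasurableSingletonClass 𝒜] {k : ℕ}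

section Extremal

/-- The weight that equals `α` below and `β` above the conditional quantile of level `t`. -/
def tiltWeight (P : ProbabilityMeasure (ObsData 𝒳 𝒜)) (a : 𝒜) (t α β : ℝ) (p : 𝒳 × ℝ) : ℝ :=
  tilt (outcomeKernel P a p.1) (condQuantile P t a p.1) t α β p.2

variable {P : ProbabilityMeasure (ObsData 𝒳 𝒜)} {a : 𝒜} {t α β Λ : ℝ}

theorem measurable_tiltWeight (ht0 : 0 < t) (ht1 : t < 1) :
    Measurable (tiltWeight P a t α β) :=
  measurable_tilt_kernel _ (measurable_quantile (outcomeKernel P a) ht0 ht1) t α β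

theorem tiltWeight_mem_Icc (ht0 : 0 < t) (ht1 : t < 1) {lo hi : ℝ} (hα : α ∈ Set.Icc lo hi)
    (hβ : β ∈ Set.Icc lo hi) (p : 𝒳 × ℝ) : tiltWeight P a t α β p ∈ Set.Icc lo hi :=
  tilt_mem_Icc (measureReal_Iio_quantile_le _ ht0 ht1) (le_measureReal_Iic_quantile _ ht0 ht1)
    hα hβ _

theorem lintegral_tiltWeight (ht0 : 0 < t) (ht1 : t < 1) (hα : α ∈ Set.Icc (1 / Λ) Λ)
    (hβ : β ∈ Set.Icc (1 / Λ) Λ) (hΛ : 0 < Λ) (h : α * t + β * (1 - t) = 1) (x : 𝒳) :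
    ∫⁻ y, ENNReal.ofReal (tiltWeight P a t α β (x, y)) ∂outcomeKernel P a x = 1 := by
  have hm : Measurable fun y => tiltWeight P a t α β (x, y) :=
    (measurable_tiltWeight ht0 ht1).comp measurable_prodMk_left
  have hmem := fun y => tiltWeight_mem_Icc (P := P) (a := a) ht0 ht1 hα hβ (x, y)
  have h0 : ∀ y, 0 ≤ tiltWeight P a t α β (x, y) := fun y =>
    le_trans (by positivity) (hmem y).1
  rw [← ofReal_integral_eq_lintegral_ofReal _ (Filter.Eventually.of_forall h0)]
  · rw [show ∫ y, tiltWeight P a t α β (x, y) ∂outcomeKernel P a x = 1 from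
      (integral_tilt (measureReal_Iio_quantile_le _ ht0 ht1)
        (le_measureReal_Iic_quantile _ ht0 ht1)).trans h, ENNReal.ofReal_one]
  · refine Integrable.of_bound hm.aestronglyMeasurable Λ (Filter.Eventually.of_forall fun y => ?_)
    rw [Real.norm_eq_abs, abs_of_nonneg (h0 y)]
    exact (hmem y).2

/-- For `c = Λ` and `c = 1 / Λ` the factor is the upper and the lower constant of
`ae_potentialLaw_bounds`. -/
theorem restrict_mixKernel_tiltWeight (ht0 : 0 < t) (ht1 : t < 1) (x : 𝒳) {s : Set ℝ}
    (hs : MeasurableSet s) {c : ℝ} (hc : ∀ y ∈ s, tiltWeight P a t α β (x, y) = c) :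
    (mixKernel P a (tiltWeight P a t α β) x).restrict s =
      (ENNReal.ofReal (prop P a x + (1 - prop P a x) * c) • outcomeKernel P a x).restrict s := by
  rw [mixKernel_apply (measurable_tiltWeight ht0 ht1), restrict_withDensity hs,
    Measure.restrict_smul, ← withDensity_const]
  refine withDensity_congr_ae ?_
  filter_upwards [ae_restrict_mem hs] with y hy
  rw [mixDensity, hc y hy]

theorem tiltWeight_of_lt {x : 𝒳} {y : ℝ} (h : y < condQuantile P t a x) :
    tiltWeight P a t α β (x, y) = α := if_pos h

theorem tiltWeight_of_gt {x : 𝒳} {y : ℝ} (h : condQuantile P t a x < y) :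
    tiltWeight P a t α β (x, y) = β := by
  unfold tiltWeight tilt
  rw [if_neg (not_lt.2 h.le), if_pos h]

/-- Without an atom, `tilt` takes the value `β` at the quantile itself, in agreement with `sgn 0 =
1`; the closed form then holds for every `y`. -/
theorem tiltWeight_of_ge {x : 𝒳} (h0 : outcomeLaw P a x {condQuantile P t a x} = 0) {y : ℝ}
    (h : condQuantile P t a x ≤ y) : tiltWeight P a t α β (x, y) = β := by
  rcases h.eq_or_lt with h | h
  · have : (outcomeKernel P a x).real {condQuantile P t a x} = 0 := by
      rw [measureReal_def, outcomeKernel_apply, h0, ENNReal.toReal_zero]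
    unfold tiltWeight tilt
    simp only
    rw [← h, if_neg (lt_irrefl _), if_neg (lt_irrefl _), if_pos this]
  · exact tiltWeight_of_gt h

theorem ae_integrable_potentialLaw [StandardBorelSpace 𝒳] {Q : ProbabilityMeasure (FullData 𝒳 𝒜 k)}
    (hΛ : 1 ≤ Λ) (hQ : Q ∈ uncertaintySet k Λ P)
    (hY : Integrable (fun z => z.2.1) (P : Measure (ObsData 𝒳 𝒜))) :
    ∀ᵐ x ∂covariateLaw P, Integrable (fun y : ℝ => y) (potentialLaw Q a x) := by
  filter_upwards [ae_potentialLaw_bounds hΛ hQ a, ae_integrable_outcomeKernel hY a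
    ((hQ.1.ae_prop_mem_Ioo hΛ hQ.2 a).mono fun x hx => hx.1)] with x h1 h2
  exact (h2.smul_measure ENNReal.ofReal_ne_top).mono_measure h1.1

theorem measurable_condMean (Q : ProbabilityMeasure (FullData 𝒳 𝒜 k)) (a : 𝒜) :
    Measurable (condMean Q a) :=
  (StronglyMeasurable.integral_condDistrib (f := Prod.snd)
    measurable_snd.stronglyMeasurable).measurable

/-- The conditional mean of `Y(a)` is largest for the weight `Λ` above the quantile. -/
theorem condMean_le_of_tiltWeight [StandardBorelSpace 𝒳]
    {Q R : ProbabilityMeasure (FullData 𝒳 𝒜 k)} (hΛ : 1 ≤ Λ)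
    (hY : Integrable (fun z => z.2.1) (P : Measure (ObsData 𝒳 𝒜))) (ht0 : 0 < t) (ht1 : t < 1)
    (hQ : Q ∈ uncertaintySet k Λ P) (hR : R ∈ uncertaintySet k Λ P)
    (h : potentialLaw R a =ᵐ[covariateLaw P] mixKernel P a (tiltWeight P a t (1 / Λ) Λ)) :
    condMean Q a ≤ᵐ[covariateLaw P] condMean R a := by
  filter_upwards [ae_potentialLaw_bounds hΛ hQ a, h,
    ae_integrable_potentialLaw (a := a) hΛ hQ hY,
    ae_integrable_potentialLaw (a := a) hΛ hR hY] with x hb hx hiQ hiR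
  -- The law under `R` equals the upper bound for `Q` above the quantile and the lower bound below
  -- it.
  refine integral_id_le_of_restrict_le hiQ hiR (condQuantile P t a x) ?_ ?_
  · rw [hx, restrict_mixKernel_tiltWeight ht0 ht1 x measurableSet_Ioi
      fun y hy => tiltWeight_of_gt hy, mul_comm]
    exact Measure.restrict_mono le_rfl hb.1
  · rw [hx, restrict_mixKernel_tiltWeight ht0 ht1 x measurableSet_Iio
      fun y hy => tiltWeight_of_lt hy, mul_one_div]
    exact Measure.restrict_mono le_rfl hb.2

/-- The conditional mean of `Y(a)` is smallest for the weight `1 / Λ` above the quantile. -/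
theorem condMean_ge_of_tiltWeight [StandardBorelSpace 𝒳]
    {Q R : ProbabilityMeasure (FullData 𝒳 𝒜 k)} (hΛ : 1 ≤ Λ)
    (hY : Integrable (fun z => z.2.1) (P : Measure (ObsData 𝒳 𝒜))) (ht0 : 0 < t) (ht1 : t < 1)
    (hQ : Q ∈ uncertaintySet k Λ P) (hR : R ∈ uncertaintySet k Λ P)
    (h : potentialLaw R a =ᵐ[covariateLaw P] mixKernel P a (tiltWeight P a t Λ (1 / Λ))) :
    condMean R a ≤ᵐ[covariateLaw P] condMean Q a := by
  filter_upwards [ae_potentialLaw_bounds hΛ hQ a, h,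
    ae_integrable_potentialLaw (a := a) hΛ hQ hY,
    ae_integrable_potentialLaw (a := a) hΛ hR hY] with x hb hx hiQ hiR
  refine integral_id_le_of_restrict_le hiR hiQ (condQuantile P t a x) ?_ ?_
  · rw [hx, restrict_mixKernel_tiltWeight ht0 ht1 x measurableSet_Ioi
      fun y hy => tiltWeight_of_gt hy, mul_one_div]
    exact Measure.restrict_mono le_rfl hb.2
  · rw [hx, restrict_mixKernel_tiltWeight ht0 ht1 x measurableSet_Iio
      fun y hy => tiltWeight_of_lt hy, mul_comm]
    exact Measure.restrict_mono le_rfl hb.1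

/-- The mean of the mixed law as an integral against the conditional law of `(Y, A)` given `X`. -/
theorem ae_integral_mixKernel_eq {lam : 𝒳 × ℝ → ℝ} (hlam : Measurable lam)
    (hpos : ∀ p, 0 < lam p) (hprop : ∀ᵐ x ∂covariateLaw P, 0 < prop P a x) :
    ∀ᵐ x ∂covariateLaw P, ∫ y, y ∂mixKernel P a lam x =
      ∫ w, w.1 * Set.indicator {a} 1 w.2 *
        (1 + (1 - prop P a x) / prop P a x * lam (x, w.1))
      ∂(condDistrib (fun z => z.2) (fun z => z.1) (P : Measure (ObsData 𝒳 𝒜)) x) := by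
  filter_upwards [map_restrict_condDistrib_ae_eq P a, hprop] with x hx hx0
  have hlx : Measurable fun y => lam (x, y) := by fun_prop
  have hm : MeasurableSet {w : ℝ × 𝒜 | w.2 = a} := measurable_snd (measurableSet_singleton a)
  set h : ℝ → ℝ := fun y => y * (1 + (1 - prop P a x) / prop P a x * lam (x, y)) with hh
  have hhm : Measurable h := by fun_prop
  have hN : Measurable fun y => ENNReal.ofReal (mixDensity P a lam (x, y)) :=
    ((measurable_mixDensity hlam).comp measurable_prodMk_left).ennreal_ofReal
  have h1 : ∀ w : ℝ × 𝒜, w.1 * Set.indicator {a} 1 w.2 *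
      (1 + (1 - prop P a x) / prop P a x * lam (x, w.1)) =
      {w : ℝ × 𝒜 | w.2 = a}.indicator (fun w => h w.1) w := by
    intro w
    by_cases hw : w.2 = a <;> simp [hw, hh]
  simp only [h1]
  rw [integral_indicator hm, ← integral_map (f := h) measurable_fst.aemeasurable
    hhm.aestronglyMeasurable, hx, integral_smul_measure, ← integral_smul, mixKernel_apply hlam,
    integral_withDensity_eq_integral_toReal_smul hN
      (Filter.Eventually.of_forall fun _ => ENNReal.ofReal_lt_top)]
  refine integral_congr_ae (Filter.Eventually.of_forall fun y => ?_)
  simp only [smul_eq_mul, hh]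
  rw [ENNReal.toReal_ofReal (mixDensity_pos hpos _).le, ENNReal.toReal_ofReal hx0.le, mixDensity]
  -- This is `e * (1 + (1 - e) / e * lam) = e + (1 - e) * lam`, where `e ≠ 0` is needed.
  field_simp

end Extremal

/-! ### Extremal weights as powers of `Λ` -/

section ClosedForm

variable {P : ProbabilityMeasure (ObsData 𝒳 𝒜)} {a : 𝒜} {Λ : ℝ}

theorem level_mem {Λ : ℝ} (hΛ : 1 ≤ Λ) :
    (0 < Λ / (1 + Λ) ∧ Λ / (1 + Λ) < 1) ∧ (0 < 1 / (1 + Λ) ∧ 1 / (1 + Λ) < 1) := by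
  have h1 : 0 < Λ := by linarith
  refine ⟨⟨by positivity, ?_⟩, by positivity, ?_⟩ <;> rw [div_lt_one (by positivity)] <;> linarith

theorem tiltWeight_plus_eq (hΛ : 1 ≤ Λ) {x : 𝒳}
    (h : Λ = 1 ∨ outcomeLaw P a x {qPlus Λ P a x} = 0) (y : ℝ) :
    tiltWeight P a (Λ / (1 + Λ)) (1 / Λ) Λ (x, y) = Λ ^ sgn (y - qPlus Λ P a x) := by
  rcases h with rfl | h
  · obtain ⟨⟨h0, h1⟩, -⟩ := level_mem hΛ
    -- For `Λ = 1` the weight is confined to `[1, 1]`, whatever the atoms.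
    have := tiltWeight_mem_Icc (P := P) (a := a) h0 h1 (lo := 1) (hi := 1) (α := 1 / 1) (β := 1)
      (by simp) (by simp) (x, y)
    rw [one_zpow]
    exact le_antisymm this.2 this.1
  · rcases lt_or_ge y (qPlus Λ P a x) with hy | hy
    · rw [tiltWeight_of_lt hy, sgn, if_neg (by linarith), zpow_neg_one, one_div]
    · rw [tiltWeight_of_ge h hy, sgn, if_pos (by linarith), zpow_one]

theorem tiltWeight_minus_eq (hΛ : 1 ≤ Λ) {x : 𝒳}
    (h : Λ = 1 ∨ outcomeLaw P a x {qMinus Λ P a x} = 0) (y : ℝ) :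
    tiltWeight P a (1 / (1 + Λ)) Λ (1 / Λ) (x, y) = Λ ^ (-sgn (y - qMinus Λ P a x)) := by
  rcases h with rfl | h
  · obtain ⟨-, h0, h1⟩ := level_mem hΛ
    have := tiltWeight_mem_Icc (P := P) (a := a) h0 h1 (lo := 1) (hi := 1) (α := 1) (β := 1 / 1)
      (by simp) (by simp) (x, y)
    rw [one_zpow]
    exact le_antisymm this.2 this.1
  · rcases lt_or_ge y (qMinus Λ P a x) with hy | hy
    · rw [tiltWeight_of_lt hy, sgn, if_neg (by linarith), neg_neg, zpow_one]
    · rw [tiltWeight_of_ge h hy, sgn, if_pos (by linarith), zpow_neg_one, one_div]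

end ClosedForm

end

end MultiMSM

end

theorem propositionB1 {𝒳 𝒜 : Type*} [MeasurableSpace 𝒳] [StandardBorelSpace 𝒳]
    [Finite 𝒜] [Nonempty 𝒜] [MeasurableSpace 𝒜] [MeasurableSingletonClass 𝒜]
    (k : ℕ) (hk : 1 ≤ k) (Λ : ℝ) (hΛ : 1 ≤ Λ)
    (P : ProbabilityMeasure (MultiMSM.ObsData 𝒳 𝒜))
    (Po : ProbabilityMeasure (MultiMSM.FullData 𝒳 𝒜 k))
    (hMSM : MultiMSM.SatisfiesMSM Λ Po)
    (hobs : (Po : Measure (MultiMSM.FullData 𝒳 𝒜 k)).map MultiMSM.observe =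
      (P : Measure (MultiMSM.ObsData 𝒳 𝒜)))
    (hY : Integrable (fun z => z.2.1) (P : Measure (MultiMSM.ObsData 𝒳 𝒜))) :
    -- the conditional means are well defined
    (∀ Q ∈ MultiMSM.uncertaintySet k Λ P, ∀ a : 𝒜, ∀ᵐ x ∂(MultiMSM.covariateLaw P),
      Integrable (fun y : ℝ => y) (MultiMSM.potentialLaw Q a x)) ∧
    -- the sharp bounds exist, are attained, and have the closed form
    ∃ μPlus μMinus : 𝒜 → 𝒳 → ℝ, ∀ a : 𝒜,
      MultiMSM.IsEssSup (MultiMSM.covariateLaw P)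
        ((fun Q => MultiMSM.condMean Q a) '' MultiMSM.uncertaintySet k Λ P) (μPlus a) ∧
      MultiMSM.IsEssInf (MultiMSM.covariateLaw P)
        ((fun Q => MultiMSM.condMean Q a) '' MultiMSM.uncertaintySet k Λ P) (μMinus a) ∧
      (∃ Q ∈ MultiMSM.uncertaintySet k Λ P, ∀ᵐ x ∂(MultiMSM.covariateLaw P),
        MultiMSM.condMean Q a x = μPlus a x) ∧
      (∃ Q ∈ MultiMSM.uncertaintySet k Λ P, ∀ᵐ x ∂(MultiMSM.covariateLaw P),
        MultiMSM.condMean Q a x = μMinus a x) ∧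
      (∀ᵐ x ∂(MultiMSM.covariateLaw P),
        (Λ = 1 ∨ MultiMSM.outcomeLaw P a x {MultiMSM.qPlus Λ P a x} = 0) →
          μPlus a x = MultiMSM.closedFormPlus Λ P a x) ∧
      (∀ᵐ x ∂(MultiMSM.covariateLaw P),
        (Λ = 1 ∨ MultiMSM.outcomeLaw P a x {MultiMSM.qMinus Λ P a x} = 0) →
          μMinus a x = MultiMSM.closedFormMinus Λ P a x) := by
  open MultiMSM in
  have hΛ0 : 0 < Λ := by linarith
  have hprop : ∀ b, ∀ᵐ x ∂covariateLaw P, 0 < prop P b x ∧ prop P b x < 1 :=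
    fun b => hMSM.ae_prop_mem_Ioo hΛ hobs b
  have hα : 1 / Λ ∈ Set.Icc (1 / Λ) Λ :=
    ⟨le_rfl, ((div_le_one hΛ0).2 hΛ).trans hΛ⟩
  have hβ : Λ ∈ Set.Icc (1 / Λ) Λ := ⟨hα.2, le_rfl⟩
  obtain ⟨⟨hp0, hp1⟩, hm0, hm1⟩ := level_mem hΛ
  have exists_tilted : ∀ (t α β : ℝ), 0 < t → t < 1 → α ∈ Set.Icc (1 / Λ) Λ →
      β ∈ Set.Icc (1 / Λ) Λ → α * t + β * (1 - t) = 1 → ∀ a, ∃ Q ∈ uncertaintySet k Λ P,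
        potentialLaw Q a =ᵐ[covariateLaw P] mixKernel P a (tiltWeight P a t α β) :=
    fun t α β ht0 ht1 hα hβ h a => exists_mem_uncertaintySet hk hΛ hprop
      (measurable_tiltWeight ht0 ht1) (tiltWeight_mem_Icc ht0 ht1 hα hβ)
      (lintegral_tiltWeight ht0 ht1 hα hβ hΛ0 h)
  have closed_form : ∀ (t α β : ℝ), 0 < t → t < 1 → α ∈ Set.Icc (1 / Λ) Λ →
      β ∈ Set.Icc (1 / Λ) Λ → ∀ (a : 𝒜) (Q : ProbabilityMeasure (FullData 𝒳 𝒜 k)),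
        potentialLaw Q a =ᵐ[covariateLaw P] mixKernel P a (tiltWeight P a t α β) →
        ∀ᵐ x ∂covariateLaw P, condMean Q a x = ∫ w, w.1 * Set.indicator {a} 1 w.2 *
          (1 + (1 - prop P a x) / prop P a x * tiltWeight P a t α β (x, w.1))
          ∂(condDistrib (fun z => z.2) (fun z => z.1) (P : Measure (ObsData 𝒳 𝒜)) x) := by
    intro t α β ht0 ht1 hα hβ a Q hQ
    filter_upwards [hQ, ae_integral_mixKernel_eq (a := a) (measurable_tiltWeight ht0 ht1)
      (fun p => lt_of_lt_of_le (one_div_pos.2 hΛ0)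
        (tiltWeight_mem_Icc (P := P) (a := a) ht0 ht1 hα hβ p).1)
      ((hprop a).mono fun x hx => hx.1)] with x h1 h2
    rw [condMean, h1, h2]
  -- The levels are the solutions of the mass-one equation `α * t + β * (1 - t) = 1`; the extremal
  -- distribution depends on `a`.
  choose Qp hQp hp using exists_tilted _ (1 / Λ) Λ hp0 hp1 hα hβ (by field_simp; ring)
  choose Qm hQm hm using exists_tilted _ Λ (1 / Λ) hm0 hm1 hβ hα (by field_simp; ring)
  refine ⟨fun Q hQ a => ae_integrable_potentialLaw hΛ hQ hY, fun a => condMean (Qp a) a,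
    fun a => condMean (Qm a) a, fun a => ⟨⟨measurable_condMean _ a, ?_, ?_⟩,
    ⟨measurable_condMean _ a, ?_, ?_⟩, ⟨Qp a, hQp a, Filter.Eventually.of_forall fun _ => rfl⟩,
    ⟨Qm a, hQm a, Filter.Eventually.of_forall fun _ => rfl⟩, ?_, ?_⟩⟩
  · rintro _ ⟨Q, hQ, rfl⟩
    exact condMean_le_of_tiltWeight hΛ hY hp0 hp1 hQ (hQp a) (hp a)
  -- The candidate belongs to the family, so every upper bound dominates it.
  · exact fun h _ hub => hub _ ⟨Qp a, hQp a, rfl⟩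
  · rintro _ ⟨Q, hQ, rfl⟩
    exact condMean_ge_of_tiltWeight hΛ hY hm0 hm1 hQ (hQm a) (hm a)
  · exact fun h _ hlb => hlb _ ⟨Qm a, hQm a, rfl⟩
  · filter_upwards [closed_form _ _ _ hp0 hp1 hα hβ a _ (hp a)] with x hx h
    simp only [hx, closedFormPlus, tiltWeight_plus_eq hΛ h]
  · filter_upwards [closed_form _ _ _ hm0 hm1 hβ hα a _ (hm a)] with x hx h
    simp only [hx, closedFormMinus, tiltWeight_minus_eq hΛ h]
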